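/- Let $n,k$ be integers with $1\le k\le n-1$, let $\Delta_{k,n}=\{x\in[0,1]^n : x_1+\cdots+x_n=k\}$, and write $x_S=\sum_{i\in S}x_i$ and $e_I=\sum_{i\in I}e_i$. **Blades.** For an ordered set partition $(S_1,\dots,S_\ell)$ of $\{1,\dots,n\}$ and integers $s_1,\dots,s_\ell$, let $[(S_1)_{s_1},\dots,(S_\ell)_{s_\ell}]$ be the cone in the hyperplane $x_1+\cdots+x_n=s_1+\cdots+s_\ell$ given by $x_{S_1\cup\cdots\cup S_t}\ge s_1+\cdots+s_t$ for $1\le t\le \ell-1$. The blade $(((S_1)_{s_1},\dots,(S_\ell)_{s_\ell}))$ is the union of the boundaries, relative to that hyperplane, of the cones $[(S_j)_{s_j},(S_{j+1})_{s_{j+1}},\dots,(S_{j-1})_{s_{j-1}}]$, $j=1,\dots,\ell$ (indices cyclic). For a cyclic order $\sigma=(\sigma_1,\dots,\sigma_n)$ and a $k$-element set $I\subseteq\{1,\dots,n\}$, the translated blade $((\sigma_1,\dots,\sigma_n))_{e_I}$ is the blade of the partition into the singletons $\{\sigma_1\},\dots,\{\sigma_n\}$ with all decorations $0$, translated by $e_I$.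 **Subdivisions.** The maximal cells induced by a finite arrangement of blades with union $B$ are the closures of the connected components of $\Delta_{k,n}\setminus B$. A polytopal subdivision of $\Delta_{k,n}$ (given by its maximal cells) is a finite set of polytopes of the same dimension as $\Delta_{k,n}$ that cover it and any two of which meet in a common (possibly empty) face. It is a matroid subdivision if every maximal cell is a matroid polytope, i.e. the convex hull of the vectors $e_B$ for the bases $B$ of a matroid on $\{1,\dots,n\}$. A positroid polytope (for the cyclic order $(1,2,\dots,n)$) is a matroid polytope whose facets are given by equations $x_i+x_{i+1}+\cdots+x_j=r$ with cyclic indices and $r\in\mathbb Z$, i.e. which is cut out, in the hyperplane $x_1+\cdots+x_n=k$, by inequalities $x_i+x_{i+1}+\cdots+x_j\ge r_{ij}$ with $r_{ij}\in\mathbb Z$. **Weak separation.** Sets $I,J$ are weakly separated with respect to $\sigma$ if there are no $i_1,i_2\in I\setminus J$ and $j_1,j_2\in J\setminus I$ that occur in the cyclic order $i_1,j_1,i_2,j_2$ with respect to $\sigma$. A collection of sets is weakly separated if its members are pairwise weakly separated. **Theorem.** 1. Let $\{I_1,\dots,I_m\}$ be a collection of $k$-element subsets of $\{1,\dots,n\}$.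 The arrangement of the blades $((1,2,\dots,n))_{e_{I_1}},\dots,((1,2,\dots,n))_{e_{I_m}}$ induces a matroid subdivision of $\Delta_{k,n}$ if and only if $\{I_1,\dots,I_m\}$ is weakly separated with respect to the cyclic order $(1,2,\dots,n)$. 2. If this arrangement induces a matroid subdivision, then every maximal cell of that subdivision is a positroid polytope. 3. (Compatibility of planar multi-splits.) Let $((S_1)_{s_1},\dots,(S_\ell)_{s_\ell})$ and $((T_1)_{t_1},\dots,(T_{\ell'})_{t_{\ell'}})$ be decorated ordered set partitions of type $\Delta_{k,n}$, i.e. $\sum_j s_j=k$ and $1\le s_j\le |S_j|-1$ for all $j$, and likewise for $(T,t)$. Let $\mathcal S$ be the multi-split of $\Delta_{k,n}$ whose maximal cells are the intersections with $\Delta_{k,n}$ of the cones $[(S_j)_{s_j},\dots,(S_{j-1})_{s_{j-1}}]$, $j=1,\dots,\ell$, and let $\mathcal T$ be the multi-split defined in the same way by $(T,t)$. Suppose that there are a cyclic order $\sigma$ and $k$-element sets $J_1,J_2$ such that $(((S_1)_{s_1},\dots,(S_\ell)_{s_\ell}))$ and $((\sigma_1,\dots,\sigma_n))_{e_{J_1}}$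 agree on the relative interior of $\Delta_{k,n}$, and $(((T_1)_{t_1},\dots,(T_{\ell'})_{t_{\ell'}}))$ and $((\sigma_1,\dots,\sigma_n))_{e_{J_2}}$ agree on the relative interior of $\Delta_{k,n}$. Then the common refinement of $\mathcal S$ and $\mathcal T$ (its maximal cells being the intersections $P\cap Q$ of maximal cells $P$ of $\mathcal S$ and $Q$ of $\mathcal T$ that have the same dimension as $\Delta_{k,n}$) is a matroid subdivision if and only if $J_1$ and $J_2$ are weakly separated with respect to $\sigma$. -/

import Mathlib

noncomputable section

namespace BladeArrangement

/-- The `0/1` vector `e_I = ∑_{i ∈ I} e_i`. -/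
def vertexVec {n : ℕ} (I : Finset (Fin n)) : Fin n → ℝ :=
  fun i => if i ∈ I then 1 else 0

/-- The hypersimplex `Δ_{k,n} = {x ∈ [0,1]^n : x_1 + ⋯ + x_n = k}`. -/
def hypersimplex (k n : ℕ) : Set (Fin n → ℝ) :=
  {x | (∀ i, x i ∈ Set.Icc (0 : ℝ) 1) ∧ ∑ i, x i = (k : ℝ)}

/-! ### Plates and blades -/

/-- The plate `[(S_1)_{s_1}, …, (S_ℓ)_{s_ℓ}]`: the polyhedral cone in the hyperplane
`x_1 + ⋯ + x_n = s_1 + ⋯ + s_ℓ` that is cut out by the inequalities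
`x_{S_1 ∪ ⋯ ∪ S_t} ≥ s_1 + ⋯ + s_t` for `t = 1, …, ℓ - 1`
(the blocks are pairwise disjoint whenever this is used). -/
def plate {n ℓ : ℕ} (S : Fin ℓ → Finset (Fin n)) (s : Fin ℓ → ℤ) : Set (Fin n → ℝ) :=
  {x | ∑ i, x i = ∑ j, (s j : ℝ) ∧
    ∀ t : Fin ℓ, (t : ℕ) + 1 < ℓ →
      ∑ j ∈ Finset.Iic t, (s j : ℝ) ≤ ∑ j ∈ Finset.Iic t, ∑ i ∈ S j, x i}

/-- The cyclic rotation `(a_j, a_{j+1}, …, a_{j-1})` of a list `(a_1, …, a_ℓ)`; the addition on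
`Fin ℓ` is modulo `ℓ`. -/
def rotate {ℓ : ℕ} {α : Type*} (a : Fin ℓ → α) (j : Fin ℓ) : Fin ℓ → α :=
  fun i => a (j + i)

/-- The blade `(((S_1)_{s_1}, …, (S_ℓ)_{s_ℓ}))`: the union of the boundaries (relative to the
ambient affine hyperplane) of the plates of the `ℓ` cyclic block rotations. -/
def blade {n ℓ : ℕ} (S : Fin ℓ → Finset (Fin n)) (s : Fin ℓ → ℤ) : Set (Fin n → ℝ) :=
  ⋃ j : Fin ℓ, intrinsicFrontier ℝ (plate (rotate S j) (rotate s j))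

/-- The translated blade `((σ_1, …, σ_n))_{e_I}`: the blade of the ordered set partition into the
singletons `{σ_1}, …, {σ_n}`, all decorations being `0`, translated by `e_I`. -/
def cyclicBlade {n : ℕ} (σ : Equiv.Perm (Fin n)) (I : Finset (Fin n)) : Set (Fin n → ℝ) :=
  (fun x => vertexVec I + x) '' blade (fun j => {σ j}) (fun _ => 0)

/-- The union of the translated blades `((σ_1, …, σ_n))_{e_I}` for `I ∈ 𝒞`. -/
def bladeArrangement {n : ℕ} (σ : Equiv.Perm (Fin n)) (𝒞 : Finset (Finset (Fin n))) :
    Set (Fin n → ℝ) :=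
  ⋃ I ∈ 𝒞, cyclicBlade σ I

/-- The chambers (maximal cells) that a set `B` of walls induces in `Q`: the closures of the
connected components of `Q \ B`. -/
def chambers {n : ℕ} (Q B : Set (Fin n → ℝ)) : Set (Set (Fin n → ℝ)) :=
  {P | ∃ x ∈ Q \ B, P = closure (connectedComponentIn (Q \ B) x)}

/-! ### Subdivisions, matroid polytopes and positroid polytopes -/

/-- `𝒟` is the set of maximal cells of a polytopal subdivision of `Q`: finitely many polytopes of
the same dimension as `Q`, with union `Q`, any two of which meet in a (possibly empty) common
face. -/
def IsPolytopalSubdivision {n : ℕ} (Q : Set (Fin n → ℝ)) (𝒟 : Set (Set (Fin n → ℝ))) : Prop :=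
  𝒟.Finite ∧ ⋃₀ 𝒟 = Q ∧
    (∀ P ∈ 𝒟, (∃ V : Set (Fin n → ℝ), V.Finite ∧ P = convexHull ℝ V) ∧
      affineSpan ℝ P = affineSpan ℝ Q) ∧
    ∀ P ∈ 𝒟, ∀ P' ∈ 𝒟, IsExposed ℝ P (P ∩ P') ∧ IsExposed ℝ P' (P ∩ P')

/-- `P` is a matroid polytope: the convex hull of the vectors `e_B`, where `B` runs over the bases
of a matroid on `{1, …, n}`. -/
def IsMatroidPolytope {n : ℕ} (P : Set (Fin n → ℝ)) : Prop :=
  ∃ M : Matroid (Fin n), M.E = Set.univ ∧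
    P = convexHull ℝ {x | ∃ B : Finset (Fin n), M.IsBase (B : Set (Fin n)) ∧ x = vertexVec B}

/-- A matroid subdivision: every maximal cell is a matroid polytope. -/
def IsMatroidSubdivision {n : ℕ} (Q : Set (Fin n → ℝ)) (𝒟 : Set (Set (Fin n → ℝ))) : Prop :=
  IsPolytopalSubdivision Q 𝒟 ∧ ∀ P ∈ 𝒟, IsMatroidPolytope P

/-- The cyclic interval `{i, i+1, …, i+m-1}` (indices modulo `n`), for `m ≤ n`. -/
def cyclicInterval {n : ℕ} (i : Fin n) (m : ℕ) : Finset (Fin n) :=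
  Finset.univ.filter fun j => ((j - i : Fin n) : ℕ) < m

/-- `P` is a positroid polytope in the hyperplane `x_1 + ⋯ + x_n = k`, with respect to the cyclic
order `(1, 2, …, n)`: a matroid polytope all of whose facets are given by equations
`x_i + x_{i+1} + ⋯ + x_{i+m-1} = r` with `r` an integer, that is, one which is cut out in that
hyperplane by inequalities `x_i + x_{i+1} + ⋯ + x_{i+m-1} ≥ r_{i,m}` with integers `r_{i,m}`, over
the proper nonempty cyclic intervals. (An upper bound is a lower bound for the complementary
cyclic interval.) -/
def IsPositroidPolytope {n : ℕ} (k : ℕ) (P : Set (Fin n → ℝ)) : Prop :=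
  IsMatroidPolytope P ∧
    ∃ r : Fin n → ℕ → ℤ, P = {x | ∑ i, x i = (k : ℝ) ∧
      ∀ i : Fin n, ∀ m : ℕ, 1 ≤ m → m < n → (r i m : ℝ) ≤ ∑ j ∈ cyclicInterval i m, x j}

/-- The maximal cells of the common refinement of two subdivisions `𝒟₁`, `𝒟₂` of `Q`. -/
def commonRefinement {n : ℕ} (Q : Set (Fin n → ℝ)) (𝒟₁ 𝒟₂ : Set (Set (Fin n → ℝ))) :
    Set (Set (Fin n → ℝ)) :=
  {R | ∃ P₁ ∈ 𝒟₁, ∃ P₂ ∈ 𝒟₂, R = P₁ ∩ P₂ ∧ affineSpan ℝ R = affineSpan ℝ Q}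

/-! ### Multi-splits from decorated ordered set partitions -/

/-- `((S_1)_{s_1}, …, (S_ℓ)_{s_ℓ})` is a decorated ordered set partition of type `Δ_{k,n}`. -/
def IsDecoratedOSP {n ℓ : ℕ} (k : ℕ) (S : Fin ℓ → Finset (Fin n)) (s : Fin ℓ → ℤ) : Prop :=
  (∀ j j', j ≠ j' → Disjoint (S j) (S j')) ∧ (∀ i, ∃ j, i ∈ S j) ∧ ∑ j, s j = (k : ℤ) ∧
    ∀ j, 1 ≤ s j ∧ s j ≤ ((S j).card : ℤ) - 1

/-- The maximal cells of the multi-split of `Δ_{k,n}` given by `((S_1)_{s_1}, …, (S_ℓ)_{s_ℓ})`: the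
nested matroid polytopes that the plates of the `ℓ` cyclic block rotations cut out of
`Δ_{k,n}`. -/
def multiSplit {n ℓ : ℕ} (k : ℕ) (S : Fin ℓ → Finset (Fin n)) (s : Fin ℓ → ℤ) :
    Set (Set (Fin n → ℝ)) :=
  Set.range fun j : Fin ℓ => plate (rotate S j) (rotate s j) ∩ hypersimplex k n

/-! ### Weak separation -/

/-- `a < b < c < d` or one of its cyclic rotations. -/
def CyclicallyOrdered {n : ℕ} (a b c d : Fin n) : Prop :=
  (a < b ∧ b < c ∧ c < d) ∨ (b < c ∧ c < d ∧ d < a) ∨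
    (c < d ∧ d < a ∧ a < b) ∨ (d < a ∧ a < b ∧ b < c)

/-- `I` and `J` are weakly separated with respect to the cyclic order `(σ_1, …, σ_n)`. The position
of `i` in that order is `σ.symm i`. -/
def WeaklySeparated {n : ℕ} (σ : Equiv.Perm (Fin n)) (I J : Finset (Fin n)) : Prop :=
  ∀ i₁ ∈ I \ J, ∀ i₂ ∈ I \ J, ∀ j₁ ∈ J \ I, ∀ j₂ ∈ J \ I,
    ¬ CyclicallyOrdered (σ.symm i₁) (σ.symm j₁) (σ.symm i₂) (σ.symm j₂)

/-- A collection of pairwise weakly separated sets. -/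
def IsWeaklySeparatedCollection {n : ℕ} (σ : Equiv.Perm (Fin n))
    (𝒞 : Finset (Finset (Fin n))) : Prop :=
  ∀ I ∈ 𝒞, ∀ J ∈ 𝒞, WeaklySeparated σ I J

end BladeArrangement

end

open BladeArrangement

/-! For a cyclic order `σ` and a `k`-set `J`, let the level of a position `u` at `x` be the partial
sum of `x` before `u` minus that of the indicator of `J`. On the hyperplane of sum `k` the levels
are periodic around the cycle, and a rotated plate says exactly that the minimal level is attained
at a given position. A blade is therefore a tropical hyperplane, the locus where the minimum is
attained at least twice (`blade_eq`, `cyclicBlade_eq`). The chambers of an arrangement are the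
full-dimensional cells on which a minimizing position is prescribed for each `J`
(`chambers_eq_fullCells`). These cells always form a polytopal subdivision with `0/1` vertices:
rounding all partial sums with a common offset preserves the level inequalities, and averaging over
the offset returns the point (`cell_eq_convexHull`). What remains is whether the vertex sets satisfy
basis exchange.

Weak separation gives exchange (`cellBases_exchange`). If no element can replace `a ∈ A \ B`, follow
the difference of the partial sums of `A` and `B` once around the cycle from just after `a`. Each
descent is a blocked exchange, hence lies inside an interval joining two minimizers of one level
function of `A`, and the difference does not decrease from the left end of such an interval to its
right end. Weak separation lets crossing intervals be merged, so the walk cannot end below its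
start, while it must end one lower.

Conversely, if `I`, `I'` are not weakly separated, their difference crosses one level upwards,
downwards, upwards, downwards (`exists_levelCrossing`). These four positions and the upper envelope
of the two sets span an octahedron. A matroid cell through its centre contains the envelope and its
antipode, hence by exchange another antipodal pair; `I` excludes one such pair and `I'` the other
(`false_of_levelCrossing`).

Level differences are sums over cyclic intervals up to integers, which makes the cells positroid
polytopes. The compatibility of multi-splits is the same equivalence for a family of two sets,
because the full cells depend only on the walls in the open hypersimplex (`fullCells_level_eq`). -/

namespace BladeArrangement

/-! ### Cells of a family of piecewise linear functions -/

section Cells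

variable {n : ℕ} {ι τ : Type*} (g : ι → τ → (Fin n → ℝ) →ᵃ[ℝ] ℝ)

/-- The points of `Q` at which, for every `i`, the minimum of `g i` is attained at `f i`. -/
def cell (Q : Set (Fin n → ℝ)) (f : ι → τ) : Set (Fin n → ℝ) :=
  {x | x ∈ Q ∧ ∀ i t, g i (f i) x ≤ g i t x}

/-- The points of `Q` at which, for every `i`, the minimum of `g i` is attained only at `f i`. -/
def openCell (Q : Set (Fin n → ℝ)) (f : ι → τ) : Set (Fin n → ℝ) :=
  {x | x ∈ Q ∧ ∀ i t, t ≠ f i → g i (f i) x < g i t x}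

/-- The points at which the minimum of some `g i` is attained at least twice. -/
def walls : Set (Fin n → ℝ) :=
  {x | ∃ i t u, t ≠ u ∧ g i t x = g i u x ∧ ∀ v, g i t x ≤ g i v x}

/-- The cells of `Q` that have an interior point. -/
def fullCells (Q : Set (Fin n → ℝ)) : Set (Set (Fin n → ℝ)) :=
  {P | ∃ f, (openCell g Q f).Nonempty ∧ P = cell g Q f}

variable {g}

lemma continuous_apply_affine (i : ι) (t : τ) : Continuous (g i t) :=
  AffineMap.continuous_of_finiteDimensional _

lemma openCell_subset_cell {Q : Set (Fin n → ℝ)} {f : ι → τ} : openCell g Q f ⊆ cell g Q f := by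
  rintro x ⟨hx, h⟩
  refine ⟨hx, fun i t => ?_⟩
  by_cases ht : t = f i
  · rw [ht]
  · exact (h i t ht).le

lemma exists_mem_openCell [Finite τ] [Nonempty τ] {K : Set (Fin n → ℝ)} {x : Fin n → ℝ}
    (hx : x ∈ K \ walls g) : ∃ f, x ∈ openCell g K f := by
  have h : ∀ i, ∃ t, ∀ u, g i t x ≤ g i u x := fun i => Finite.exists_min (fun t => g i t x)
  choose f hf using h
  refine ⟨f, hx.1, fun i t ht => lt_of_le_of_ne (hf i t) fun he => hx.2 ?_⟩
  exact ⟨i, f i, t, Ne.symm ht, he, hf i⟩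

lemma openCell_subset_diff_walls {K : Set (Fin n → ℝ)} {f : ι → τ} :
    openCell g K f ⊆ K \ walls g := by
  rintro x ⟨hx, h⟩
  refine ⟨hx, ?_⟩
  rintro ⟨i, t, u, htu, he, hm⟩
  by_cases ht : t = f i
  · have := h i u (by rw [← ht]; exact htu.symm)
    rw [← ht] at this; exact absurd he this.ne
  · exact absurd (hm (f i)) (not_le.2 (h i t ht))

lemma eq_of_mem_openCell {K K' : Set (Fin n → ℝ)} {f f' : ι → τ} {x : Fin n → ℝ}
    (h : x ∈ openCell g K f) (h' : x ∈ openCell g K' f') : f = f' := by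
  funext i
  by_contra hne
  exact lt_asymm (h.2 i (f' i) (Ne.symm hne)) (h'.2 i (f i) hne)

/-- A convex combination of weak and strict inequalities is strict as soon as the strict one has
positive weight. The hypothesis on `U` covers both `U = Q` convex and `U` the open hypersimplex
inside the closed one. -/
lemma lineMap_mem_openCell {Q U : Set (Fin n → ℝ)}
    (hU : ∀ x ∈ Q, ∀ y ∈ U, ∀ ε : ℝ, 0 < ε → ε ≤ 1 → AffineMap.lineMap x y ε ∈ U)
    {f : ι → τ} {x y : Fin n → ℝ} (hx : x ∈ cell g Q f) (hy : y ∈ openCell g U f) {ε : ℝ}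
    (h0 : 0 < ε) (h1 : ε ≤ 1) : AffineMap.lineMap x y ε ∈ openCell g U f := by
  refine ⟨hU x hx.1 y hy.1 ε h0 h1, fun i t ht => ?_⟩
  rw [AffineMap.apply_lineMap, AffineMap.apply_lineMap, AffineMap.lineMap_apply_ring,
    AffineMap.lineMap_apply_ring]
  have a := hx.2 i t
  have b := hy.2 i t ht
  nlinarith [mul_le_mul_of_nonneg_left a (sub_nonneg.2 h1), mul_lt_mul_of_pos_left b h0]

lemma lineMap_mem_of_convex {Q : Set (Fin n → ℝ)} (hQ : Convex ℝ Q) :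
    ∀ x ∈ Q, ∀ y ∈ Q, ∀ ε : ℝ, 0 < ε → ε ≤ 1 → AffineMap.lineMap x y ε ∈ Q :=
  fun _ hx _ hy _ h0 h1 => hQ.lineMap_mem hx hy ⟨h0.le, h1⟩

lemma convex_openCell {K : Set (Fin n → ℝ)} (hK : Convex ℝ K) (f : ι → τ) :
    Convex ℝ (openCell g K f) := by
  rw [convex_iff_forall_pos]
  intro x hx y hy a b ha hb hab
  have := lineMap_mem_openCell (lineMap_mem_of_convex hK) (openCell_subset_cell hx) hy hb
    (by linarith)
  rw [AffineMap.lineMap_apply_module] at this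
  rwa [← hab, add_sub_cancel_right] at this

lemma isClosed_cell {Q : Set (Fin n → ℝ)} (hQ : IsClosed Q) (f : ι → τ) :
    IsClosed (cell g Q f) := by
  have : cell g Q f = Q ∩ ⋂ i, ⋂ t, {x | g i (f i) x ≤ g i t x} := by
    ext x; simp [cell]
  rw [this]
  exact hQ.inter (isClosed_iInter fun i => isClosed_iInter fun t =>
    isClosed_le (continuous_apply_affine i _) (continuous_apply_affine i _))

lemma convex_cell {Q : Set (Fin n → ℝ)}
    (hQ : Convex ℝ Q) (f : ι → τ) :
    Convex ℝ (cell g Q f) := by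
  have : cell g Q f = Q ∩ ⋂ i, ⋂ t, (g i (f i) - g i t) ⁻¹' Set.Iic 0 := by
    ext x; simp [cell]
  rw [this]
  exact hQ.inter (convex_iInter fun i => convex_iInter fun t =>
    (convex_Iic 0).affine_preimage _)

lemma isOpen_openCell_univ [Finite ι] [Finite τ] (f : ι → τ) :
    IsOpen (openCell g Set.univ f) := by
  have : openCell g Set.univ f = ⋂ i, ⋂ t, {x | t ≠ f i → g i (f i) x < g i t x} := by
    ext x; simp [openCell]
  rw [this]
  refine isOpen_iInter_of_finite fun i => isOpen_iInter_of_finite fun t => ?_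
  by_cases ht : t = f i
  · simp [ht]
  · simpa [ht] using isOpen_lt (continuous_apply_affine i _) (continuous_apply_affine i _)

lemma tendsto_lineMap_zero (x y : Fin n → ℝ) :
    Filter.Tendsto (fun ε : ℝ => AffineMap.lineMap x y ε) (nhdsWithin 0 (Set.Ioi 0))
      (nhds x) := by
  have : Continuous (fun ε : ℝ => AffineMap.lineMap x y ε) := AffineMap.lineMap_continuous
  have h := this.tendsto 0
  simp only [AffineMap.lineMap_apply_zero] at h
  exact h.mono_left nhdsWithin_le_nhds

lemma closure_openCell {Q U : Set (Fin n → ℝ)} (hQ : IsClosed Q) (hUQ : U ⊆ Q)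
    (hU : ∀ x ∈ Q, ∀ y ∈ U, ∀ ε : ℝ, 0 < ε → ε ≤ 1 → AffineMap.lineMap x y ε ∈ U)
    {f : ι → τ} (hne : (openCell g U f).Nonempty) :
    closure (openCell g U f) = cell g Q f := by
  apply subset_antisymm
  · refine closure_minimal ?_ (isClosed_cell hQ f)
    exact fun x hx => openCell_subset_cell ⟨hUQ hx.1, hx.2⟩
  · intro x hx
    obtain ⟨y, hy⟩ := hne
    refine mem_closure_of_tendsto (tendsto_lineMap_zero x y) ?_
    filter_upwards [Ioc_mem_nhdsGT (zero_lt_one (α := ℝ))] with ε hε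
    exact lineMap_mem_openCell hU hx hy hε.1 hε.2

lemma openCell_nonempty_of_dense [Finite ι] [Finite τ] {Q U : Set (Fin n → ℝ)}
    (hU : ∀ x ∈ Q, ∀ y ∈ U, ∀ ε : ℝ, 0 < ε → ε ≤ 1 → AffineMap.lineMap x y ε ∈ U)
    (hne : U.Nonempty) {f : ι → τ} (h : (openCell g Q f).Nonempty) :
    (openCell g U f).Nonempty := by
  obtain ⟨x, hx⟩ := h
  obtain ⟨y, hy⟩ := hne
  have h1 := (tendsto_lineMap_zero x y).eventually
    ((isOpen_openCell_univ f).mem_nhds (⟨trivial, hx.2⟩ : x ∈ openCell g Set.univ f))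
  obtain ⟨ε, h2, hε⟩ := (h1.and (Ioc_mem_nhdsGT (zero_lt_one (α := ℝ)))).exists
  exact ⟨_, hU x hx.1 y hy ε hε.1 hε.2, h2.2⟩

/-- The open cells are open, pairwise disjoint and cover the complement of the walls, so a component
lies in one of them; each is convex, hence connected. -/
lemma connectedComponentIn_walls [Finite ι] [Finite τ] [Nonempty τ] {K : Set (Fin n → ℝ)}
    (hK : Convex ℝ K) {f : ι → τ} {x : Fin n → ℝ} (hx : x ∈ openCell g K f) :
    connectedComponentIn (K \ walls g) x = openCell g K f := by
  have hxK : x ∈ K \ walls g := openCell_subset_diff_walls hx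
  apply subset_antisymm
  · have hsub : connectedComponentIn (K \ walls g) x ⊆ openCell g Set.univ f := by
      refine IsPreconnected.subset_left_of_subset_union (isOpen_openCell_univ f)
        (v := ⋃ f' : {f' // f' ≠ f}, openCell g Set.univ f'.1)
        (isOpen_iUnion fun f' => isOpen_openCell_univ _) ?_ ?_ ?_
        isPreconnected_connectedComponentIn
      · rw [Set.disjoint_iUnion_right]
        rintro ⟨f', hf'⟩
        rw [Set.disjoint_left]
        intro z hz hz'
        exact hf' (eq_of_mem_openCell hz' hz)
      · intro z hz
        obtain ⟨f', hf'⟩ := exists_mem_openCell (connectedComponentIn_subset _ _ hz)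
        by_cases h : f' = f
        · exact Or.inl ⟨trivial, h ▸ hf'.2⟩
        · exact Or.inr (Set.mem_iUnion.2 ⟨⟨f', h⟩, trivial, hf'.2⟩)
      · exact ⟨x, mem_connectedComponentIn hxK, trivial, hx.2⟩
    intro z hz
    exact ⟨(connectedComponentIn_subset _ _ hz).1, (hsub hz).2⟩
  · exact (convex_openCell hK f).isPreconnected.subset_connectedComponentIn hx
      openCell_subset_diff_walls

/-- The chambers are taken in `U` and the cells in `Q`, so that blades known to agree only on the
open hypersimplex can still be compared. -/
theorem chambers_eq_fullCells [Finite ι] [Finite τ] [Nonempty τ] {Q U B : Set (Fin n → ℝ)}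
    (hQ : IsClosed Q) (hUQ : U ⊆ Q) (hUne : U.Nonempty)
    (hU : ∀ x ∈ Q, ∀ y ∈ U, ∀ ε : ℝ, 0 < ε → ε ≤ 1 → AffineMap.lineMap x y ε ∈ U)
    (hUc : Convex ℝ U) (hB : ∀ x ∈ U, x ∈ B ↔ x ∈ walls g) :
    chambers U B = fullCells g Q := by
  have hUB : U \ B = U \ walls g := by
    ext x; simp only [Set.mem_sdiff]
    exact ⟨fun h => ⟨h.1, fun h' => h.2 ((hB x h.1).2 h')⟩,
      fun h => ⟨h.1, fun h' => h.2 ((hB x h.1).1 h')⟩⟩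
  ext P
  simp only [chambers, fullCells, Set.mem_ofPred_eq, hUB]
  constructor
  · rintro ⟨x, hx, rfl⟩
    obtain ⟨f, hf⟩ := exists_mem_openCell hx
    refine ⟨f, ⟨x, hUQ hf.1, hf.2⟩, ?_⟩
    rw [connectedComponentIn_walls hUc hf, closure_openCell hQ hUQ hU ⟨x, hf⟩]
  · rintro ⟨f, hf, rfl⟩
    obtain ⟨x, hx⟩ := openCell_nonempty_of_dense hU hUne hf
    refine ⟨x, openCell_subset_diff_walls hx, ?_⟩
    rw [connectedComponentIn_walls hUc hx, closure_openCell hQ hUQ hU ⟨x, hx⟩]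

lemma finite_fullCells [Finite ι] [Finite τ] (Q : Set (Fin n → ℝ)) : (fullCells g Q).Finite := by
  refine (Set.finite_range (fun f => cell g Q f)).subset ?_
  rintro P ⟨f, -, rfl⟩
  exact ⟨f, rfl⟩

lemma finite_setOf_lineMap_mem_walls [Finite ι] [Finite τ] (x : Fin n → ℝ) {y : Fin n → ℝ}
    (hgen : ∀ i t u, t ≠ u → g i t y ≠ g i u y) :
    {ε : ℝ | ε ≠ 0 ∧ AffineMap.lineMap x y ε ∈ walls g}.Finite := by
  have : {ε : ℝ | ε ≠ 0 ∧ AffineMap.lineMap x y ε ∈ walls g} ⊆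
      ⋃ i, ⋃ t, ⋃ u : {u // t ≠ u},
        {ε : ℝ | ε ≠ 0 ∧ g i t (AffineMap.lineMap x y ε) = g i u.1 (AffineMap.lineMap x y ε)} := by
    rintro ε ⟨h0, i, t, u, htu, he, -⟩
    simp only [Set.mem_iUnion]
    exact ⟨i, t, ⟨u, htu⟩, h0, he⟩
  refine Set.Finite.subset ?_ this
  refine Set.finite_iUnion fun i => Set.finite_iUnion fun t => Set.finite_iUnion fun u => ?_
  apply Set.Subsingleton.finite
  -- Along the line the difference of two of the functions is affine in the parameter and nonzero at
  -- parameter `1`, so it has at most one zero.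
  rintro a ⟨ha, hea⟩ b ⟨hb, heb⟩
  simp only [AffineMap.apply_lineMap, AffineMap.lineMap_apply_ring] at hea heb
  have hne := sub_ne_zero.2 (hgen i t u.1 u.2)
  have e1 : (a - b) * (g i t y - g i u.1 y - (g i t x - g i u.1 x)) = 0 := by linarith
  rcases mul_eq_zero.1 e1 with h | h
  · linarith
  · exfalso
    apply hne
    have e2 : g i t x - g i u.1 x = g i t y - g i u.1 y := by linarith
    have e3 : (1 - a) * (g i t x - g i u.1 x) + a * (g i t y - g i u.1 y) = 0 := by linarith
    rw [e2] at e3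
    linarith

/-- From any point, a small move towards the generic point `y` leaves all walls and lands in an open
cell; finitely many closed cells then cover the limit point too. -/
theorem sUnion_fullCells [Finite ι] [Finite τ] [Nonempty τ] {Q : Set (Fin n → ℝ)}
    (hQ : IsClosed Q) (hQc : Convex ℝ Q) {y : Fin n → ℝ} (hy : y ∈ Q)
    (hgen : ∀ i t u, t ≠ u → g i t y ≠ g i u y) : ⋃₀ fullCells g Q = Q := by
  apply subset_antisymm
  · rintro x ⟨P, ⟨f, -, rfl⟩, hx⟩
    exact hx.1
  · intro x hx
    have hcl : IsClosed (⋃₀ fullCells g Q) := by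
      rw [Set.sUnion_eq_biUnion]
      refine (finite_fullCells Q).isClosed_biUnion ?_
      rintro P ⟨f, -, rfl⟩
      exact isClosed_cell hQ f
    rw [← hcl.closure_eq]
    refine mem_closure_of_tendsto (tendsto_lineMap_zero x y) ?_
    have hfin := finite_setOf_lineMap_mem_walls x hgen
    have h1 : {ε : ℝ | ε ≠ 0 ∧ AffineMap.lineMap x y ε ∈ walls g}ᶜ ∈
        nhdsWithin (0 : ℝ) (Set.Ioi 0) :=
      nhdsWithin_le_nhds (hfin.isClosed.isOpen_compl.mem_nhds (by simp))
    filter_upwards [Ioc_mem_nhdsGT (zero_lt_one (α := ℝ)), h1] with ε hε h2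
    have h3 : AffineMap.lineMap x y ε ∈ Q \ walls g :=
      ⟨lineMap_mem_of_convex hQc x hx y hy ε hε.1 hε.2, fun h => h2 ⟨hε.1.ne', h⟩⟩
    obtain ⟨f, hf⟩ := exists_mem_openCell h3
    exact ⟨_, ⟨f, ⟨_, hf⟩, rfl⟩, openCell_subset_cell hf⟩

lemma affineSpan_cell [Finite ι] [Finite τ] {Q : Set (Fin n → ℝ)} (hQc : Convex ℝ Q) {f : ι → τ}
    (h : (openCell g Q f).Nonempty) : affineSpan ℝ (cell g Q f) = affineSpan ℝ Q := by
  apply le_antisymm (affineSpan_mono ℝ fun x hx => hx.1)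
  rw [affineSpan_le]
  intro y hy
  obtain ⟨x, hx⟩ := h
  have h1 := (tendsto_lineMap_zero x y).eventually
    ((isOpen_openCell_univ f).mem_nhds (⟨trivial, hx.2⟩ : x ∈ openCell g Set.univ f))
  obtain ⟨ε, h2, hε⟩ := (h1.and (Ioc_mem_nhdsGT (zero_lt_one (α := ℝ)))).exists
  have h3 : AffineMap.lineMap x y ε ∈ cell g Q f :=
    openCell_subset_cell ⟨lineMap_mem_of_convex hQc x hx.1 y hy ε hε.1 hε.2, h2.2⟩
  have h4 := AffineMap.lineMap_mem ε⁻¹ (subset_affineSpan ℝ _ (openCell_subset_cell hx))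
    (subset_affineSpan ℝ _ h3)
  -- Near `x` the cell contains a shrunken copy of `Q`; the homothety of ratio `ε⁻¹` at `x` undoes
  -- the shrinking.
  have h5 : AffineMap.lineMap x (AffineMap.lineMap x y ε) ε⁻¹ = y := by
    rw [AffineMap.lineMap_lineMap_right, inv_mul_cancel₀ hε.1.ne', AffineMap.lineMap_apply_one]
  rwa [h5] at h4

/-- An inequality that is an equality on the whole cell would be one on its span, which contains the
generic point `y`. So each inequality is strict somewhere on the cell, and taking successive
midpoints makes all of them strict at once. -/
lemma openCell_nonempty_of_affineSpan [Finite ι] [Finite τ] {Q : Set (Fin n → ℝ)}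
    (hQc : Convex ℝ Q) {y : Fin n → ℝ} (hy : y ∈ Q)
    (hgen : ∀ i t u, t ≠ u → g i t y ≠ g i u y) {f : ι → τ}
    (h : affineSpan ℝ (cell g Q f) = affineSpan ℝ Q) : (openCell g Q f).Nonempty := by
  classical
  have := Fintype.ofFinite ι
  have := Fintype.ofFinite τ
  have hconv := convex_cell (g := g) hQc f
  have hstep : ∀ i t, t ≠ f i → ∃ x ∈ cell g Q f, g i (f i) x < g i t x := by
    intro i t ht
    by_contra hcon
    push Not at hcon
    have heq : ∀ x ∈ cell g Q f, (g i t - g i (f i)) x = 0 := by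
      intro x hx
      have h1 := hcon x hx
      have h2 := hx.2 i t
      simp only [AffineMap.coe_sub, Pi.sub_apply]; linarith
    have hmem : y ∈ affineSpan ℝ (cell g Q f) := h ▸ subset_affineSpan ℝ Q hy
    have hle : affineSpan ℝ (cell g Q f) ≤
        (AffineSubspace.mk' (0 : ℝ) ⊥).comap (g i t - g i (f i)) := by
      rw [affineSpan_le]
      intro x hx
      have := heq x hx
      simp only [AffineMap.coe_sub, Pi.sub_apply] at this
      simp [this]
    have h3 := hle hmem
    rw [AffineSubspace.mem_comap, AffineSubspace.mem_mk'] at h3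
    simp only [AffineMap.coe_sub, Pi.sub_apply, vsub_eq_sub, sub_zero, Submodule.mem_bot] at h3
    exact hgen i t (f i) ht (sub_eq_zero.1 h3)
  suffices H : ∀ s : Finset (ι × τ), ∃ x ∈ cell g Q f, ∀ p ∈ s, p.2 ≠ f p.1 →
      g p.1 (f p.1) x < g p.1 p.2 x by
    obtain ⟨x, hx, hs⟩ := H Finset.univ
    exact ⟨x, hx.1, fun i t ht => hs (i, t) (Finset.mem_univ _) ht⟩
  intro s
  induction s using Finset.induction_on with
  | empty =>
    have : (cell g Q f).Nonempty := by
      rw [← affineSpan_nonempty ℝ, h, affineSpan_nonempty]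
      exact ⟨y, hy⟩
    obtain ⟨x, hx⟩ := this
    exact ⟨x, hx, by simp⟩
  | insert p s _ ih =>
    obtain ⟨x, hx, hs⟩ := ih
    by_cases hp : p.2 = f p.1
    · refine ⟨x, hx, fun q hq hqf => ?_⟩
      rcases Finset.mem_insert.1 hq with rfl | hq
      · exact absurd hp hqf
      · exact hs q hq hqf
    · obtain ⟨z, hz, hlt⟩ := hstep p.1 p.2 hp
      refine ⟨AffineMap.lineMap x z (1 / 2 : ℝ), hconv.lineMap_mem hx hz (by norm_num), ?_⟩
      intro q hq hqf
      rw [AffineMap.apply_lineMap, AffineMap.apply_lineMap, AffineMap.lineMap_apply_ring,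
        AffineMap.lineMap_apply_ring]
      have a := hx.2 q.1 q.2
      have b := hz.2 q.1 q.2
      rcases Finset.mem_insert.1 hq with rfl | hq
      · linarith
      · have := hs q hq hqf
        linarith

lemma mem_fullCells_iff [Finite ι] [Finite τ] {Q : Set (Fin n → ℝ)} (hQ : Convex ℝ Q)
    {y : Fin n → ℝ} (hy : y ∈ Q) (hgen : ∀ i t u, t ≠ u → g i t y ≠ g i u y) {P : Set (Fin n → ℝ)} :
    P ∈ fullCells g Q ↔ P ∈ Set.range (cell g Q) ∧ affineSpan ℝ P = affineSpan ℝ Q := by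
  constructor
  · rintro ⟨f, hf, rfl⟩
    exact ⟨⟨f, rfl⟩, affineSpan_cell hQ hf⟩
  · rintro ⟨⟨f, rfl⟩, h⟩
    exact ⟨f, openCell_nonempty_of_affineSpan hQ hy hgen h, rfl⟩

/-- The sum over `i` of `g i (f i) - g i (f' i)` is nonpositive on the cell of `f` and vanishes
there exactly on the cell of `f'`; its linear part is the exposing functional. -/
lemma isExposed_cell_inter [Finite ι] {Q : Set (Fin n → ℝ)} (f f' : ι → τ) :
    IsExposed ℝ (cell g Q f) (cell g Q f ∩ cell g Q f') := by
  have := Fintype.ofFinite ι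
  rintro ⟨x₀, hx₀, hx₀'⟩
  let A : (Fin n → ℝ) → ℝ := fun x => ∑ i, (g i (f i) x - g i (f' i) x)
  have hA : ∀ x, A x = ∑ i, (g i (f i) x - g i (f' i) x) := fun x => rfl
  let l : (Fin n → ℝ) →ₗ[ℝ] ℝ := ∑ i, ((g i (f i)).linear - (g i (f' i)).linear)
  have hlin : ∀ x y, l x - l y = A x - A y := by
    intro x y
    have h : ∀ i t, (g i t).linear (x - y) = g i t x - g i t y :=
      fun i t => (g i t).linearMap_vsub x y
    rw [← map_sub, hA, hA, ← Finset.sum_sub_distrib]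
    simp only [l, LinearMap.sum_apply, LinearMap.sub_apply, h]
    exact Finset.sum_congr rfl fun i _ => by ring
  have hle : ∀ y ∈ cell g Q f, A y ≤ 0 := by
    intro y hy
    rw [hA]
    exact Finset.sum_nonpos fun i _ => sub_nonpos.2 (hy.2 i _)
  have h0 : A x₀ = 0 := by
    rw [hA]
    exact Finset.sum_eq_zero fun i _ =>
      sub_eq_zero.2 (le_antisymm (hx₀.2 i _) (hx₀'.2 i _))
  refine ⟨LinearMap.toContinuousLinearMap l, ?_⟩
  ext x
  simp only [Set.mem_inter_iff, Set.mem_ofPred_eq, LinearMap.coe_toContinuousLinearMap']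
  constructor
  · rintro ⟨hx, hx'⟩
    refine ⟨hx, fun y hy => ?_⟩
    have h1 : A x = 0 := by
      rw [hA]
      exact Finset.sum_eq_zero fun i _ =>
        sub_eq_zero.2 (le_antisymm (hx.2 i _) (hx'.2 i _))
    have := hlin y x
    have := hle y hy
    linarith
  · rintro ⟨hx, hmax⟩
    refine ⟨hx, hx.1, fun i t => ?_⟩
    have h1 : A x = 0 := by
      have := hmax x₀ hx₀
      have := hlin x x₀
      have := hle x hx
      linarith
    rw [hA, Finset.sum_eq_zero_iff_of_nonpos (fun i _ => sub_nonpos.2 (hx.2 i _))] at h1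
    have h2 := h1 i (Finset.mem_univ _)
    have h3 := hx.2 i t
    linarith

theorem isPolytopalSubdivision_fullCells [Finite ι] [Finite τ] [Nonempty τ]
    {Q : Set (Fin n → ℝ)} (hQ : IsClosed Q) (hQc : Convex ℝ Q) {y : Fin n → ℝ} (hy : y ∈ Q)
    (hgen : ∀ i t u, t ≠ u → g i t y ≠ g i u y)
    (hpoly : ∀ f, ∃ V : Set (Fin n → ℝ), V.Finite ∧ cell g Q f = convexHull ℝ V) :
    IsPolytopalSubdivision Q (fullCells g Q) := by
  refine ⟨finite_fullCells Q, sUnion_fullCells hQ hQc hy hgen, ?_, ?_⟩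
  · rintro P ⟨f, hf, rfl⟩
    exact ⟨hpoly f, affineSpan_cell hQc hf⟩
  · rintro P ⟨f, hf, rfl⟩ P' ⟨f', hf', rfl⟩
    refine ⟨isExposed_cell_inter f f', ?_⟩
    rw [Set.inter_comm]
    exact isExposed_cell_inter f' f

end Cells

/-! ### Cyclic partial sums -/

section CycSum

variable {ℓ : ℕ} [NeZero ℓ] {M : Type*} [AddCommGroup M]

/-- The partial sum `y 0 + ⋯ + y (m - 1)` of the periodic extension of `y` to the naturals. -/
def cycSum (y : Fin ℓ → M) (m : ℕ) : M := ∑ i ∈ Finset.range m, y (Fin.ofNat ℓ i)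

@[simp] lemma cycSum_zero (y : Fin ℓ → M) : cycSum y 0 = 0 := by simp [cycSum]

lemma cycSum_succ (y : Fin ℓ → M) (m : ℕ) :
    cycSum y (m + 1) = cycSum y m + y (Fin.ofNat ℓ m) := by
  simp [cycSum, Finset.sum_range_succ]

lemma cycSum_period (y : Fin ℓ → M) : cycSum y ℓ = ∑ i, y i := by
  rw [cycSum, ← Fin.sum_univ_eq_sum_range (fun i => y (Fin.ofNat ℓ i))]
  exact Finset.sum_congr rfl fun i _ => by simp

lemma cycSum_add_period (y : Fin ℓ → M) (m : ℕ) :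
    cycSum y (m + ℓ) = cycSum y m + ∑ i, y i := by
  induction m with
  | zero => simp [cycSum_period]
  | succ m ih =>
    have : Fin.ofNat ℓ (m + ℓ) = Fin.ofNat ℓ m := by
      apply Fin.ext; simp
    rw [show m + 1 + ℓ = m + ℓ + 1 by ring, cycSum_succ, cycSum_succ, ih, this]
    abel

lemma cycSum_val (y : Fin ℓ → M) (u : Fin ℓ) : cycSum y u = ∑ i ∈ Finset.Iio u, y i := by
  rw [cycSum]
  symm
  refine Finset.sum_bij (fun i _ => (i : ℕ)) ?_ ?_ ?_ ?_
  · intro i hi; simpa using hi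
  · intro i _ j _ h; exact Fin.ext h
  · intro m hm
    have hm' : m < u := by simpa using hm
    exact ⟨⟨m, hm'.trans u.2⟩, by simpa [Fin.lt_def] using hm', rfl⟩
  · intro i _; simp

lemma sum_Iic_rotate (y : Fin ℓ → M) (j t : Fin ℓ) :
    ∑ i ∈ Finset.Iic t, y (j + i) = cycSum y (j + t + 1) - cycSum y j := by
  have h1 : ∀ m : ℕ, ∑ i ∈ Finset.range m, y (Fin.ofNat ℓ (j + i)) =
      cycSum y (j + m) - cycSum y j := by
    intro m
    induction m with
    | zero => simp
    | succ m ih => rw [Finset.sum_range_succ, ih, ← add_assoc, cycSum_succ]; abel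
  rw [add_assoc, ← h1]
  refine Finset.sum_bij (fun i _ => (i : ℕ)) ?_ ?_ ?_ ?_
  · intro i hi; simpa [Nat.lt_succ_iff] using hi
  · intro i _ j _ h; exact Fin.ext h
  · intro m hm
    have hm' : m ≤ t := by simpa [Nat.lt_succ_iff] using hm
    exact ⟨⟨m, hm'.trans_lt t.2⟩, by simpa [Fin.le_def] using hm', rfl⟩
  · intro i _
    congr 1

lemma exists_fin_cycSum_eq {y : Fin ℓ → M} (hy : ∑ i, y i = 0) (m : ℕ) :
    ∃ u : Fin ℓ, cycSum y m = cycSum y u ∧ (u : ℕ) = m % ℓ := by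
  refine ⟨Fin.ofNat ℓ m, ?_, by simp⟩
  rw [show ((Fin.ofNat ℓ m : Fin ℓ) : ℕ) = m % ℓ by simp]
  conv_lhs => rw [← Nat.mod_add_div m ℓ]
  generalize m / ℓ = q
  induction q with
  | zero => simp
  | succ q ih => rw [Nat.mul_succ, ← add_assoc, cycSum_add_period, hy, add_zero, ih]

/-- A partial sum started at `j` is a difference of two cyclic partial sums, and these are periodic
because the total is zero. The inequalities of a rotated plate thus say that `j` minimizes. -/
lemma rotate_partial_sums_nonneg_iff {y : Fin ℓ → ℝ} (hy : ∑ i, y i = 0) (j : Fin ℓ) :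
    (∀ t : Fin ℓ, (t : ℕ) + 1 < ℓ → 0 ≤ ∑ i ∈ Finset.Iic t, y (j + i)) ↔
      ∀ u : Fin ℓ, cycSum y j ≤ cycSum y u := by
  have hℓ : 0 < ℓ := Nat.pos_of_ne_zero (NeZero.ne ℓ)
  constructor
  · intro h u
    by_cases hu : u = j
    · rw [hu]
    rcases lt_or_gt_of_ne (fun h => hu (Fin.ext h) : (u : ℕ) ≠ j) with hlt | hgt
    -- A position before `j` is reached by wrapping around once.
    · have h1 := h ⟨u + ℓ - j - 1, by omega⟩ (by simp only; omega)
      rw [sum_Iic_rotate] at h1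
      simp only at h1
      rw [show (j : ℕ) + (u + ℓ - j - 1) + 1 = u + ℓ by omega, cycSum_add_period, hy] at h1
      linarith
    · have h1 := h ⟨u - j - 1, by omega⟩ (by simp only; omega)
      rw [sum_Iic_rotate] at h1
      simp only at h1
      rw [show (j : ℕ) + (u - j - 1) + 1 = u by omega] at h1
      linarith
  · intro h t _
    rw [sum_Iic_rotate]
    obtain ⟨u, hu, -⟩ := exists_fin_cycSum_eq hy (j + t + 1)
    rw [hu]
    exact sub_nonneg.2 (h u)

end CycSum

/-! ### Plates and blades through level functions -/

section Blades

/-- The affine hyperplane `x_1 + ⋯ + x_n = c`. -/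
def sumHyperplane (n : ℕ) (c : ℝ) : AffineSubspace ℝ (Fin n → ℝ) where
  carrier := {x | ∑ i, x i = c}
  smul_vsub_vadd_mem' := by
    intro r p q s hp hq hs
    simp only [Set.mem_ofPred_eq] at *
    simp only [vsub_eq_sub, vadd_eq_add, Pi.add_apply, Pi.smul_apply, Pi.sub_apply, smul_eq_mul,
      Finset.sum_add_distrib, ← Finset.mul_sum, Finset.sum_sub_distrib, hp, hq, hs]
    ring

lemma mem_sumHyperplane {n : ℕ} {c : ℝ} {x : Fin n → ℝ} :
    x ∈ sumHyperplane n c ↔ ∑ i, x i = c := Iff.rfl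

/-- By `hst` no defining inequality is an implicit equality. If one were tight at an interior point
`x`, prolonging the segment from a strict witness `z` slightly beyond `x` would violate it inside
the cell. -/
lemma mem_intrinsicInterior_cell {n : ℕ} {ι τ : Type*} [Finite ι] [Finite τ]
    {g : ι → τ → (Fin n → ℝ) →ᵃ[ℝ] ℝ} (H : AffineSubspace ℝ (Fin n → ℝ)) {f : ι → τ}
    (hst : ∀ i t, t ≠ f i → ∃ z ∈ cell g H f, g i (f i) z < g i t z) {x : Fin n → ℝ} :
    x ∈ intrinsicInterior ℝ (cell g H f) ↔ x ∈ openCell g H f := by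
  have hspan : affineSpan ℝ (cell g H f) ≤ H := affineSpan_le.2 fun y hy => hy.1
  rw [mem_intrinsicInterior]
  constructor
  · rintro ⟨⟨x, hxs⟩, hx, rfl⟩
    have hxC : x ∈ cell g H f := (interior_subset hx :
      (⟨x, hxs⟩ : affineSpan ℝ (cell g H f)) ∈ (↑) ⁻¹' (cell g (H : Set (Fin n → ℝ)) f))
    refine ⟨hxC.1, fun i t ht => ?_⟩
    obtain ⟨z, hz, hlt⟩ := hst i t ht
    let γ : ℝ → affineSpan ℝ (cell g H f) := fun ε =>
      ⟨AffineMap.lineMap x z ε, AffineMap.lineMap_mem ε hxs (subset_affineSpan ℝ _ hz)⟩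
    have hγ : Continuous γ := AffineMap.lineMap_continuous.subtype_mk _
    have hγ0 : γ 0 = ⟨x, hxs⟩ := Subtype.ext (by simp [γ])
    have h1 : ∀ᶠ ε in nhds (0 : ℝ), γ ε ∈ interior ((↑) ⁻¹' (cell g (H : Set (Fin n → ℝ)) f)) :=
      (hγ.tendsto 0).eventually (isOpen_interior.mem_nhds (hγ0 ▸ hx))
    have h2 : ∀ᶠ ε in nhdsWithin (0 : ℝ) (Set.Iio 0),
        γ ε ∈ interior ((↑) ⁻¹' (cell g (H : Set (Fin n → ℝ)) f)) :=
      h1.filter_mono nhdsWithin_le_nhds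
    obtain ⟨ε, h3, h4⟩ := (h2.and self_mem_nhdsWithin).exists
    have h5 : AffineMap.lineMap x z ε ∈ cell g H f :=
      (interior_subset h3 : γ ε ∈ (↑) ⁻¹' (cell g (H : Set (Fin n → ℝ)) f))
    have h6 := h5.2 i t
    rw [AffineMap.apply_lineMap, AffineMap.apply_lineMap, AffineMap.lineMap_apply_ring,
      AffineMap.lineMap_apply_ring] at h6
    have h4' : ε < 0 := h4
    by_contra hcon
    have h7 : g i (f i) x = g i t x := le_antisymm (hxC.2 i t) (not_lt.1 hcon)
    rw [h7] at h6
    have : 0 < (-ε) * (g i t z - g i (f i) z) := mul_pos (by linarith) (by linarith)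
    linarith
  · intro hx
    refine ⟨⟨x, subset_affineSpan ℝ _ (openCell_subset_cell hx)⟩, ?_, rfl⟩
    rw [mem_interior]
    refine ⟨(↑) ⁻¹' (openCell g Set.univ f), ?_,
      (isOpen_openCell_univ f).preimage continuous_subtype_val, trivial, hx.2⟩
    rintro ⟨y, hy⟩ h
    exact openCell_subset_cell ⟨hspan hy, h.2⟩

lemma mem_intrinsicFrontier_of_isClosed {n : ℕ} {C : Set (Fin n → ℝ)} (hC : IsClosed C)
    {x : Fin n → ℝ} : x ∈ intrinsicFrontier ℝ C ↔ x ∈ C ∧ x ∉ intrinsicInterior ℝ C := by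
  rw [← intrinsicClosure_sdiff_intrinsicInterior,
    (hC.preimage continuous_subtype_val).intrinsicClosure]
  rfl

variable {n ℓ : ℕ}

/-- `S` is an ordered set partition into nonempty blocks. -/
structure IsOrderedPartition (S : Fin ℓ → Finset (Fin n)) : Prop where
  disjoint : ∀ j j', j ≠ j' → Disjoint (S j) (S j')
  cover : ∀ i, ∃ j, i ∈ S j
  nonempty : ∀ j, (S j).Nonempty

/-- The total excess of a point over the decorations of the blocks before block `u`. -/
def level (S : Fin ℓ → Finset (Fin n)) (s : Fin ℓ → ℤ) (u : Fin ℓ) : (Fin n → ℝ) →ᵃ[ℝ] ℝ :=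
  (∑ i ∈ Finset.Iio u, ∑ a ∈ S i, LinearMap.proj a : (Fin n → ℝ) →ₗ[ℝ] ℝ).toAffineMap -
    AffineMap.const ℝ _ (∑ i ∈ Finset.Iio u, (s i : ℝ))

lemma level_apply (S : Fin ℓ → Finset (Fin n)) (s : Fin ℓ → ℤ) (u : Fin ℓ) (x : Fin n → ℝ) :
    level S s u x = ∑ i ∈ Finset.Iio u, (∑ a ∈ S i, x a - (s i : ℝ)) := by
  simp [level]

lemma level_eq_cycSum [NeZero ℓ] (S : Fin ℓ → Finset (Fin n)) (s : Fin ℓ → ℤ) (u : Fin ℓ)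
    (x : Fin n → ℝ) : level S s u x = cycSum (fun i => ∑ a ∈ S i, x a - (s i : ℝ)) u := by
  rw [level_apply, cycSum_val]

lemma IsOrderedPartition.sum_sum {S : Fin ℓ → Finset (Fin n)} (hS : IsOrderedPartition S)
    {M : Type*} [AddCommMonoid M] (x : Fin n → M) : ∑ j, ∑ a ∈ S j, x a = ∑ a, x a := by
  classical
  rw [← Finset.sum_biUnion fun i _ j _ h => hS.disjoint i j h]
  congr 1
  ext a; simpa using hS.cover a

lemma IsOrderedPartition.neZero {S : Fin ℓ → Finset (Fin n)} (hS : IsOrderedPartition S)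
    [NeZero n] : NeZero ℓ := by
  obtain ⟨j, -⟩ := hS.cover 0
  exact ⟨fun h => (h ▸ j).elim0⟩

variable [NeZero ℓ]

lemma plate_rotate {S : Fin ℓ → Finset (Fin n)} (hS : IsOrderedPartition S) (s : Fin ℓ → ℤ)
    (j : Fin ℓ) : plate (rotate S j) (rotate s j) =
      cell (fun _ : Unit => level S s) (sumHyperplane n (∑ i, (s i : ℝ))) fun _ => j := by
  ext x
  have hs : ∑ i, ((rotate s j i : ℤ) : ℝ) = ∑ i, (s i : ℝ) :=
    Equiv.sum_comp (Equiv.addLeft j) (fun i => (s i : ℝ))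
  simp only [plate, cell, Set.mem_ofPred_eq, hs, SetLike.mem_coe, mem_sumHyperplane]
  refine and_congr_right fun hx => ?_
  have hy : ∑ i, (∑ a ∈ S i, x a - (s i : ℝ)) = 0 := by
    rw [Finset.sum_sub_distrib, hS.sum_sum, hx, sub_self]
  have h := rotate_partial_sums_nonneg_iff hy j
  simp only [Finset.sum_sub_distrib, sub_nonneg] at h
  simp only [level_eq_cycSum, forall_const]
  exact h

/-- Concentrating the mass of each block on one representative realizes any increments. They
telescope to zero around the cycle, so the total is right. This supplies the strict witnesses that
identify the boundary of a plate. -/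
lemma exists_level_eq {S : Fin ℓ → Finset (Fin n)} (hS : IsOrderedPartition S) (s : Fin ℓ → ℤ)
    (h : Fin ℓ → ℝ) : ∃ x : Fin n → ℝ, ∑ i, x i = ∑ j, (s j : ℝ) ∧
      ∀ u, level S s u x = h u - h 0 := by
  classical
  choose rep hrep using hS.nonempty
  choose blk hblk using hS.cover
  have hblk_eq : ∀ j, ∀ a ∈ S j, blk a = j := by
    intro j a ha
    by_contra hne
    exact (Finset.disjoint_left.1 (hS.disjoint _ _ hne)) (hblk a) ha
  let h' : ℕ → ℝ := fun m => h (Fin.ofNat ℓ m)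
  let x : Fin n → ℝ := fun a =>
    if a = rep (blk a) then h' (blk a + 1) - h' (blk a) + s (blk a) else 0
  have hx : ∀ j, ∑ a ∈ S j, x a = h' (j + 1) - h' j + s j := by
    intro j
    rw [Finset.sum_eq_single (rep j)]
    · simp [x, hblk_eq j _ (hrep j)]
    · intro b hb hne
      simp [x, hblk_eq j b hb, hne]
    · intro hn; exact absurd (hrep j) hn
  have htel : ∀ m ≤ ℓ, cycSum (fun j : Fin ℓ => h' (j + 1) - h' j) m = h' m - h' 0 := by
    intro m hm
    induction m with
    | zero => simp
    | succ m ih =>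
      have : m % ℓ = m := Nat.mod_eq_of_lt (by omega)
      rw [cycSum_succ, ih (by omega)]
      simp [this]
  refine ⟨x, ?_, fun u => ?_⟩
  · rw [← hS.sum_sum, Finset.sum_congr rfl fun j _ => hx j, Finset.sum_add_distrib,
      ← cycSum_period, htel ℓ le_rfl]
    have : h' ℓ = h' 0 := by
      simp only [h']; congr 1; apply Fin.ext; simp
    rw [this]; ring
  · rw [level_eq_cycSum]
    simp only [hx, add_sub_cancel_right]
    rw [htel u u.2.le]
    simp [h']

/-- The boundary of the plate at `j` is where `j` minimizes together with another position; the
union over `j` is the tropical hyperplane of the levels. -/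
theorem blade_eq {S : Fin ℓ → Finset (Fin n)} (hS : IsOrderedPartition S) (s : Fin ℓ → ℤ) :
    blade S s = {x | ∑ i, x i = ∑ j, (s j : ℝ) ∧ x ∈ walls fun _ : Unit => level S s} := by
  have hclosed : IsClosed ((sumHyperplane n (∑ i, (s i : ℝ)) : Set (Fin n → ℝ))) :=
    AffineSubspace.closed_of_finiteDimensional _
  ext x
  simp only [blade, Set.mem_iUnion, plate_rotate hS, Set.mem_ofPred_eq]
  have key : ∀ j : Fin ℓ, x ∈ intrinsicFrontier ℝ (cell (fun _ : Unit => level S s)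
      (sumHyperplane n (∑ i, (s i : ℝ))) fun _ => j) ↔
      ∑ i, x i = ∑ j, (s j : ℝ) ∧ (∀ u, level S s j x ≤ level S s u x) ∧
        ∃ u, u ≠ j ∧ level S s j x = level S s u x := by
    intro j
    rw [mem_intrinsicFrontier_of_isClosed (isClosed_cell hclosed _), mem_intrinsicInterior_cell]
    · simp only [cell, openCell, Set.mem_ofPred_eq, SetLike.mem_coe, mem_sumHyperplane,
        forall_const]
      constructor
      · rintro ⟨⟨h1, h2⟩, h3⟩
        refine ⟨h1, h2, ?_⟩
        by_contra hcon
        push Not at hcon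
        exact h3 ⟨h1, fun t ht => lt_of_le_of_ne (h2 t) (hcon t ht)⟩
      · rintro ⟨h1, h2, u, hu, he⟩
        exact ⟨⟨h1, h2⟩, fun h => absurd he (h.2 u hu).ne⟩
    · intro _ t ht
      obtain ⟨z, hz, hl⟩ := exists_level_eq hS s (fun u => if u = j then 0 else 1)
      refine ⟨z, ⟨hz, fun _ u => ?_⟩, ?_⟩
      · simp only [hl, if_true]
        split_ifs <;> norm_num
      · simp only [hl, if_true]
        rw [if_neg ht]; linarith
  simp only [key]
  constructor
  · rintro ⟨j, h1, h2, u, hu, he⟩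
    exact ⟨h1, (), j, u, hu.symm, he, h2⟩
  · rintro ⟨h1, _, j, u, hu, he, h2⟩
    exact ⟨j, h1, h2, u, hu.symm, he⟩

lemma isOrderedPartition_singleton (σ : Equiv.Perm (Fin n)) :
    IsOrderedPartition fun j => ({σ j} : Finset (Fin n)) where
  disjoint j j' h := by
    simpa using fun h' : j = j' => h h'
  cover i := ⟨σ.symm i, by simp⟩
  nonempty j := by simp

/-- The indicator of `J`, read in the order `σ`. -/
def indic (σ : Equiv.Perm (Fin n)) (J : Finset (Fin n)) (j : Fin n) : ℤ :=
  if σ j ∈ J then 1 else 0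

/-- The level functions of the blade `((σ_1, …, σ_n))_{e_J}`. -/
def cycLevel (σ : Equiv.Perm (Fin n)) (J : Finset (Fin n)) (u : Fin n) : (Fin n → ℝ) →ᵃ[ℝ] ℝ :=
  level (fun j => {σ j}) (indic σ J) u

lemma sum_indic (σ : Equiv.Perm (Fin n)) (J : Finset (Fin n)) :
    ∑ j, (indic σ J j : ℝ) = J.card := by
  have := Equiv.sum_comp σ (fun i => if i ∈ J then (1 : ℝ) else 0)
  simp only [indic, Int.cast_ite, Int.cast_one, Int.cast_zero]
  rw [this]; simp

lemma sum_indic_int (σ : Equiv.Perm (Fin n)) (A : Finset (Fin n)) :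
    ∑ j, indic σ A j = A.card := by
  have := sum_indic σ A
  exact_mod_cast this

theorem cyclicBlade_eq [NeZero n] (σ : Equiv.Perm (Fin n)) (J : Finset (Fin n)) :
    cyclicBlade σ J =
      {x | ∑ i, x i = (J.card : ℝ) ∧ x ∈ walls fun _ : Unit => cycLevel σ J} := by
  have hlev : ∀ u x, level (fun j => ({σ j} : Finset (Fin n))) (fun _ => 0) u x =
      cycLevel σ J u (vertexVec J + x) := by
    intro u x
    simp [cycLevel, level_apply, indic, vertexVec]
  have hsum : ∑ i, vertexVec J i = (J.card : ℝ) := by simp [vertexVec]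
  rw [cyclicBlade, blade_eq (isOrderedPartition_singleton σ)]
  ext x
  simp only [Set.mem_image, Set.mem_ofPred_eq, walls, hlev]
  constructor
  · rintro ⟨y, ⟨hy, h⟩, rfl⟩
    refine ⟨?_, h⟩
    simp only [Pi.add_apply, Finset.sum_add_distrib, hy, hsum]; simp
  · rintro ⟨hx, h⟩
    refine ⟨x - vertexVec J, ⟨?_, ?_⟩, by simp⟩
    · simp only [Pi.sub_apply, Finset.sum_sub_distrib, hx, hsum]; simp
    · simpa using h

end Blades

/-! ### The hypersimplex -/

section Hypersimplex

variable {k n : ℕ}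

lemma isClosed_hypersimplex (k n : ℕ) : IsClosed (hypersimplex k n) := by
  have : hypersimplex k n =
      (⋂ i, {x | x i ∈ Set.Icc (0 : ℝ) 1}) ∩ {x | ∑ i, x i = (k : ℝ)} := by
    ext x; simp [hypersimplex]
  rw [this]
  refine (isClosed_iInter fun i => isClosed_Icc.preimage (continuous_apply i)).inter ?_
  exact isClosed_eq (by fun_prop) continuous_const

lemma convex_hypersimplex (k n : ℕ) : Convex ℝ (hypersimplex k n) := by
  intro x hx y hy a b ha hb hab
  refine ⟨fun i => convex_Icc 0 1 (hx.1 i) (hy.1 i) ha hb hab, ?_⟩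
  simp only [Pi.add_apply, Pi.smul_apply, smul_eq_mul, Finset.sum_add_distrib, ← Finset.mul_sum,
    hx.2, hy.2]
  rw [← add_mul, hab, one_mul]

/-- The points of the hypersimplex all of whose coordinates lie strictly between `0` and `1`. -/
def openHypersimplex (k n : ℕ) : Set (Fin n → ℝ) :=
  {x | (∀ i, x i ∈ Set.Ioo (0 : ℝ) 1) ∧ ∑ i, x i = (k : ℝ)}

lemma openHypersimplex_subset : openHypersimplex k n ⊆ hypersimplex k n :=
  fun _ hx => ⟨fun i => ⟨(hx.1 i).1.le, (hx.1 i).2.le⟩, hx.2⟩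

lemma lineMap_mem_openHypersimplex : ∀ x ∈ hypersimplex k n, ∀ y ∈ openHypersimplex k n,
    ∀ ε : ℝ, 0 < ε → ε ≤ 1 → AffineMap.lineMap x y ε ∈ openHypersimplex k n := by
  intro x hx y hy ε h0 h1
  have h := lineMap_mem_of_convex (convex_hypersimplex k n) x hx y (openHypersimplex_subset hy)
    ε h0 h1
  refine ⟨fun i => ?_, h.2⟩
  rw [AffineMap.lineMap_apply_module]
  simp only [Pi.add_apply, Pi.smul_apply, smul_eq_mul]
  have a := hx.1 i
  have b := hy.1 i
  have h2 : 0 ≤ (1 - ε) * x i := mul_nonneg (by linarith) a.1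
  have h3 : (1 - ε) * x i ≤ (1 - ε) * 1 := mul_le_mul_of_nonneg_left a.2 (by linarith)
  have h4 : 0 < ε * y i := mul_pos h0 b.1
  have h5 : ε * y i < ε * 1 := mul_lt_mul_of_pos_left b.2 h0
  constructor <;> linarith

lemma convex_openHypersimplex : Convex ℝ (openHypersimplex k n) := by
  rw [convex_iff_forall_pos]
  intro x hx y hy a b ha hb hab
  have := lineMap_mem_openHypersimplex x (openHypersimplex_subset hx) y hy b hb (by linarith)
  rw [AffineMap.lineMap_apply_module] at this
  rwa [← hab, add_sub_cancel_right] at this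

lemma openHypersimplex_subset_intrinsicInterior :
    openHypersimplex k n ⊆ intrinsicInterior ℝ (hypersimplex k n) := by
  intro x hx
  have hspan : affineSpan ℝ (hypersimplex k n) ≤ sumHyperplane n k :=
    affineSpan_le.2 fun y hy => hy.2
  rw [mem_intrinsicInterior]
  refine ⟨⟨x, subset_affineSpan ℝ _ (openHypersimplex_subset hx)⟩, ?_, rfl⟩
  rw [mem_interior]
  refine ⟨(↑) ⁻¹' (⋂ i, {x : Fin n → ℝ | x i ∈ Set.Ioo (0 : ℝ) 1}), ?_,
    (isOpen_iInter_of_finite fun i => isOpen_Ioo.preimage (continuous_apply i)).preimage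
      continuous_subtype_val, ?_⟩
  · rintro ⟨y, hy⟩ h
    have h' : ∀ i, y i ∈ Set.Ioo (0 : ℝ) 1 := by simpa using h
    exact openHypersimplex_subset ⟨h', hspan hy⟩
  · have h' := hx.1
    simpa using h'

/-- A point of the open hypersimplex none of whose proper partial sums is an integer. -/
lemma exists_generic_point (hk : 1 ≤ k) (hkn : k + 1 ≤ n) :
    ∃ y ∈ openHypersimplex k n, ∀ D : Finset (Fin n), D.Nonempty → D ≠ Finset.univ →
      ∀ m : ℤ, ∑ i ∈ D, y i ≠ m := by
  have : NeZero n := ⟨by omega⟩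
  have hn : (0 : ℝ) < n - 1 := by
    have : (2 : ℝ) ≤ n := by exact_mod_cast (by omega : 2 ≤ n)
    linarith
  have hk1 : (1 : ℝ) ≤ k := by exact_mod_cast hk
  have hkn1 : (k : ℝ) + 1 ≤ n := by exact_mod_cast hkn
  -- All coordinates but the one at `0` equal `α`, and that one is `k - (n - 1) * α`; the bounds on
  -- `α` put it strictly between `0` and `1`.
  obtain ⟨α, hα, h1, h2⟩ := exists_irrational_btwn
    (show ((k : ℝ) - 1) / (n - 1) < k / (n - 1) by gcongr; linarith)
  rw [div_lt_iff₀ hn] at h1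
  rw [lt_div_iff₀ hn] at h2
  have hα0 : 0 < α := by
    by_contra hcon
    have : α * (n - 1) ≤ 0 := mul_nonpos_of_nonpos_of_nonneg (not_lt.1 hcon) hn.le
    linarith
  have hα1 : α < 1 := by
    by_contra hcon
    have : 1 * ((n : ℝ) - 1) ≤ α * (n - 1) := mul_le_mul_of_nonneg_right (not_lt.1 hcon) hn.le
    linarith
  let y : Fin n → ℝ := fun i => α + if i = 0 then k - n * α else 0
  have hsum : ∀ D : Finset (Fin n), ∑ i ∈ D, y i = D.card * α + if 0 ∈ D then k - n * α else 0 := by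
    intro D
    simp [y, Finset.sum_add_distrib]
  refine ⟨y, ⟨fun i => ?_, ?_⟩, ?_⟩
  · simp only [y]
    split_ifs
    · constructor <;> linarith
    · constructor <;> linarith
  · rw [hsum]; simp
  · intro D hD hDu m he
    rw [hsum] at he
    have hc : D.card < n := by
      have := Finset.card_lt_card ((Finset.ssubset_univ_iff).2 hDu)
      simpa using this
    have hc0 : 0 < D.card := hD.card_pos
    split_ifs at he with h0
    · have hirr : Irrational (((n - D.card : ℕ) : ℝ) * α) :=
        hα.natCast_mul (by omega)
      apply hirr
      refine ⟨((k - m : ℤ) : ℚ), ?_⟩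
      push_cast [Nat.cast_sub hc.le]
      linarith
    · apply hα.natCast_mul hc0.ne'
      refine ⟨(m : ℚ), ?_⟩
      push_cast
      linarith

/-- The difference of two levels is, up to sign, a coordinate sum over the blocks between them minus
an integer; these blocks form a nonempty proper subset. -/
lemma level_ne_of_generic {ℓ : ℕ} {S : Fin ℓ → Finset (Fin n)} (hS : IsOrderedPartition S)
    (s : Fin ℓ → ℤ) {y : Fin n → ℝ}
    (hy : ∀ D : Finset (Fin n), D.Nonempty → D ≠ Finset.univ → ∀ m : ℤ, ∑ i ∈ D, y i ≠ m) :
    ∀ t u, t ≠ u → level S s t y ≠ level S s u y := by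
  classical
  suffices H : ∀ t u, t < u → level S s t y ≠ level S s u y by
    intro t u h
    rcases lt_or_gt_of_ne h with h | h
    · exact H t u h
    · exact (H u t h).symm
  intro t u htu he
  have hsplit : Finset.Iio u = Finset.Iio t ∪ Finset.Ico t u := by
    ext i
    simp only [Finset.mem_Iio, Finset.mem_union, Finset.mem_Ico]
    constructor
    · intro h
      rcases lt_or_ge i t with h' | h'
      · exact Or.inl h'
      · exact Or.inr ⟨h', h⟩
    · rintro (h | h)
      · exact h.trans htu
      · exact h.2
  have hdisj : Disjoint (Finset.Iio t) (Finset.Ico t u) := by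
    rw [Finset.disjoint_left]
    intro i hi hi'
    exact absurd (Finset.mem_Ico.1 hi').1 (not_le.2 (Finset.mem_Iio.1 hi))
  rw [level_apply, level_apply, hsplit, Finset.sum_union hdisj] at he
  have he' : ∑ i ∈ Finset.Ico t u, (∑ a ∈ S i, y a - (s i : ℝ)) = 0 := by linarith
  rw [Finset.sum_sub_distrib, ← Finset.sum_biUnion fun i _ j _ h => hS.disjoint i j h] at he'
  refine hy _ ?_ ?_ (∑ i ∈ Finset.Ico t u, s i) (by push_cast; linarith)
  · obtain ⟨a, ha⟩ := hS.nonempty t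
    exact ⟨a, Finset.mem_biUnion.2 ⟨t, by simpa using htu, ha⟩⟩
  · intro huniv
    obtain ⟨a, ha⟩ := hS.nonempty u
    have : a ∈ (Finset.Ico t u).biUnion S := huniv ▸ Finset.mem_univ a
    obtain ⟨i, hi, hai⟩ := Finset.mem_biUnion.1 this
    have hne : i ≠ u := (Finset.mem_Ico.1 hi).2.ne
    exact Finset.disjoint_left.1 (hS.disjoint i u hne) hai ha

lemma vertexVec_mem_hypersimplex {B : Finset (Fin n)} :
    vertexVec B ∈ hypersimplex k n ↔ B.card = k := by
  simp only [hypersimplex, Set.mem_ofPred_eq, vertexVec]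
  constructor
  · rintro ⟨-, h⟩
    simpa using h
  · intro h
    refine ⟨fun i => ?_, by simp [h]⟩
    split_ifs <;> simp

end Hypersimplex

/-! ### Integrality of cells -/

section Integrality

open MeasureTheory

/-- The floor exceeds `⌊a⌋` by one exactly on an interval of length `Int.fract a`. -/
lemma integral_floor_add (a : ℝ) : ∫ θ in Set.Ico (0 : ℝ) 1, (⌊a + θ⌋ : ℝ) = a := by
  have h : ∀ θ ∈ Set.Ico (0 : ℝ) 1,
      (⌊a + θ⌋ : ℝ) = ⌊a⌋ + (Set.Ico (1 - Int.fract a) 1).indicator (fun _ => (1 : ℝ)) θ := by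
    rintro θ ⟨h0, h1⟩
    have ha := Int.floor_add_fract a
    have hf0 := Int.fract_nonneg a
    have hf1 := Int.fract_lt_one a
    by_cases hθ : 1 - Int.fract a ≤ θ
    · rw [Set.indicator_of_mem (Set.mem_Ico.2 ⟨hθ, h1⟩)]
      have : ⌊a + θ⌋ = ⌊a⌋ + 1 := by
        rw [Int.floor_eq_iff]; push_cast; constructor <;> linarith
      rw [this]; push_cast; rfl
    · rw [Set.indicator_of_notMem (fun h => hθ h.1)]
      have : ⌊a + θ⌋ = ⌊a⌋ := by
        push Not at hθ
        rw [Int.floor_eq_iff]; constructor <;> linarith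
      rw [this]; simp
  rw [setIntegral_congr_fun measurableSet_Ico h, integral_add, setIntegral_indicator
    measurableSet_Ico]
  · have hsub : Set.Ico (0 : ℝ) 1 ∩ Set.Ico (1 - Int.fract a) 1 = Set.Ico (1 - Int.fract a) 1 := by
      rw [Set.inter_eq_right]
      exact Set.Ico_subset_Ico_left (by linarith [Int.fract_lt_one a])
    rw [hsub]
    simp [Int.fract_nonneg]
  · simp
  · exact (integrable_const (1 : ℝ)).indicator measurableSet_Ico

lemma integrable_floor_add (a : ℝ) :
    IntegrableOn (fun θ : ℝ => (⌊a + θ⌋ : ℝ)) (Set.Ico (0 : ℝ) 1) := by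
  refine Measure.integrableOn_of_bounded (M := |a| + 2) (by simp) ?_ ?_
  · exact (measurable_from_top.comp
      (Int.measurable_floor.comp (measurable_const.add measurable_id))).aestronglyMeasurable
  · refine (ae_restrict_mem measurableSet_Ico).mono ?_
    rintro θ ⟨h0, h1⟩
    rw [Real.norm_eq_abs, abs_le]
    have h2 := Int.floor_le (a + θ)
    have h3 := Int.lt_floor_add_one (a + θ)
    have h4 := neg_abs_le a
    have h5 := le_abs_self a
    constructor <;> linarith

variable {k n : ℕ} [NeZero n]

lemma cycLevel_eq (σ : Equiv.Perm (Fin n)) (J : Finset (Fin n)) (u : Fin n) (x : Fin n → ℝ) :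
    cycLevel σ J u x = cycSum (x ∘ σ) u - (cycSum (indic σ J) u : ℤ) := by
  rw [cycLevel, level_eq_cycSum]
  simp [cycSum, Finset.sum_sub_distrib]

lemma cycSum_vertexVec (σ : Equiv.Perm (Fin n)) (B : Finset (Fin n)) (m : ℕ) :
    cycSum (vertexVec B ∘ σ) m = (cycSum (indic σ B) m : ℤ) := by
  simp [cycSum, vertexVec, indic]

variable {ι : Type*} {σ : Equiv.Perm (Fin n)} {J : ι → Finset (Fin n)} {f : ι → Fin n}

/-- The rounding of `x` with offset `θ`, through its partial sums in the order `σ`. -/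
noncomputable def rounding (σ : Equiv.Perm (Fin n)) (x : Fin n → ℝ) (θ : ℝ) (i : Fin n) : ℝ :=
  ⌊cycSum (x ∘ σ) ((σ.symm i : ℕ) + 1) + θ⌋ - ⌊cycSum (x ∘ σ) (σ.symm i) + θ⌋

lemma cycSum_succ_of_symm (σ : Equiv.Perm (Fin n)) (x : Fin n → ℝ) (i : Fin n) :
    cycSum (x ∘ σ) ((σ.symm i : ℕ) + 1) = cycSum (x ∘ σ) (σ.symm i) + x i := by
  rw [cycSum_succ]
  simp

lemma cycSum_rounding (x : Fin n → ℝ) {θ : ℝ} (hθ : θ ∈ Set.Ico (0 : ℝ) 1) {m : ℕ} (hm : m ≤ n) :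
    cycSum (rounding σ x θ ∘ σ) m = ⌊cycSum (x ∘ σ) m + θ⌋ := by
  induction m with
  | zero =>
    have : ⌊θ⌋ = 0 := Int.floor_eq_zero_iff.2 hθ
    simp [this]
  | succ m ih =>
    have : m % n = m := Nat.mod_eq_of_lt (by omega)
    rw [cycSum_succ, ih (by omega)]
    simp [rounding, this]

/-- Consecutive partial sums differ by a number in `[0,1]`, so the rounded increments are `0` or
`1`. Each cell inequality compares two partial sums up to an integer, and the floor is monotone and
commutes with integer shifts. -/
lemma rounding_mem_cell {x : Fin n → ℝ}
    (hx : x ∈ cell (fun l => cycLevel σ (J l)) (hypersimplex k n) f) {θ : ℝ}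
    (hθ : θ ∈ Set.Ico (0 : ℝ) 1) :
    ∃ B, vertexVec B ∈ cell (fun l => cycLevel σ (J l)) (hypersimplex k n) f ∧
      rounding σ x θ = vertexVec B := by
  classical
  have h01 : ∀ i, rounding σ x θ i = 0 ∨ rounding σ x θ i = 1 := by
    intro i
    have hxi := hx.1.1 i
    rw [rounding, cycSum_succ_of_symm]
    generalize cycSum (x ∘ σ) (σ.symm i) = c
    have h1 : ⌊c + θ⌋ ≤ ⌊c + x i + θ⌋ := Int.floor_le_floor (by linarith [hxi.1])
    have h2 : ⌊c + x i + θ⌋ ≤ ⌊c + θ⌋ + 1 := by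
      rw [← Int.floor_add_one]; exact Int.floor_le_floor (by linarith [hxi.2])
    have h3 : ⌊c + x i + θ⌋ = ⌊c + θ⌋ ∨ ⌊c + x i + θ⌋ = ⌊c + θ⌋ + 1 := by omega
    rcases h3 with h | h
    · left; rw [h, sub_self]
    · right; rw [h]; push_cast; ring
  have hB : rounding σ x θ = vertexVec (Finset.univ.filter fun i => rounding σ x θ i = 1) := by
    funext i
    rcases h01 i with h | h <;> simp [vertexVec, h]
  refine ⟨_, ?_, hB⟩
  rw [← hB]
  refine ⟨⟨fun i => ?_, ?_⟩, fun l t => ?_⟩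
  · rcases h01 i with h | h <;> simp [h]
  · have h1 := cycSum_rounding (σ := σ) x hθ (le_refl n)
    rw [cycSum_period, cycSum_period] at h1
    have h2 : ∀ z : Fin n → ℝ, ∑ i, (z ∘ σ) i = ∑ i, z i := fun z => Equiv.sum_comp σ z
    rw [h2, h2, hx.1.2, Int.floor_natCast_add, Int.floor_eq_zero_iff.2 hθ] at h1
    simpa using h1
  · have h := hx.2 l t
    rw [cycLevel_eq, cycLevel_eq] at h ⊢
    rw [cycSum_rounding x hθ (f l).2.le, cycSum_rounding x hθ t.2.le]
    have h1 : ⌊cycSum (x ∘ σ) (f l) + θ⌋ ≤ ⌊cycSum (x ∘ σ) t + θ⌋ +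
        (cycSum (indic σ (J l)) (f l) - cycSum (indic σ (J l)) t) := by
      rw [← Int.floor_add_intCast]
      refine Int.floor_le_floor ?_
      push_cast; linarith
    have h2 : (⌊cycSum (x ∘ σ) (f l) + θ⌋ : ℝ) ≤ ((⌊cycSum (x ∘ σ) t + θ⌋ +
        (cycSum (indic σ (J l)) (f l) - cycSum (indic σ (J l)) t) : ℤ) : ℝ) := by exact_mod_cast h1
    push_cast at h2
    linarith

/-- The vertex sets of a cell. -/
def cellBases (k : ℕ) (σ : Equiv.Perm (Fin n)) (J : ι → Finset (Fin n)) (f : ι → Fin n) :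
    Set (Finset (Fin n)) :=
  {B | vertexVec B ∈ cell (fun l => cycLevel σ (J l)) (hypersimplex k n) f}

theorem cell_eq_convexHull :
    cell (fun l => cycLevel σ (J l)) (hypersimplex k n) f =
      convexHull ℝ (vertexVec '' cellBases k σ J f) := by
  apply subset_antisymm
  · intro x hx
    have hV : (vertexVec '' cellBases k σ J f).Finite := (Set.toFinite _).image _
    have hprob : IsProbabilityMeasure (volume.restrict (Set.Ico (0 : ℝ) 1)) := ⟨by simp⟩
    have hint : ∀ i, Integrable (fun θ => rounding σ x θ i) (volume.restrict (Set.Ico (0 : ℝ) 1)) :=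
      fun i => (integrable_floor_add _).sub (integrable_floor_add _)
    -- The point `x` is the mean of its roundings over a uniform offset, and each rounding is a
    -- vertex of the cell.
    have hmem := (convex_convexHull ℝ (vertexVec '' cellBases k σ J f)).integral_mem
      (μ := volume.restrict (Set.Ico (0 : ℝ) 1)) (f := fun θ => rounding σ x θ)
      (hV.isClosed_convexHull ℝ) ?_ (Integrable.of_eval hint)
    · convert hmem
      funext i
      rw [eval_integral hint]
      simp only [rounding]
      rw [integral_sub (integrable_floor_add _) (integrable_floor_add _), integral_floor_add,
        integral_floor_add, cycSum_succ_of_symm]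
      ring
    · refine (ae_restrict_mem measurableSet_Ico).mono fun θ hθ => ?_
      obtain ⟨B, hB, he⟩ := rounding_mem_cell hx hθ
      rw [he]
      exact subset_convexHull ℝ _ ⟨B, hB, rfl⟩
  · refine convexHull_min ?_ (convex_cell (convex_hypersimplex k n) f)
    rintro _ ⟨B, hB, rfl⟩
    exact hB

end Integrality

/-! ### Weak separation and basis exchange -/

section Exchange

lemma card_insert_erase {α : Type*} [DecidableEq α] {A : Finset α} {a b : α} (ha : a ∈ A)
    (hb : b ∉ A) :
    (insert b (A.erase a)).card = A.card := by
  rw [Finset.card_insert_of_notMem (fun h => hb (Finset.mem_of_mem_erase h)),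
    Finset.card_erase_of_mem ha]
  have := Finset.card_pos.2 ⟨a, ha⟩
  omega

variable {n : ℕ} [NeZero n]

/-- The difference of the partial sums of the indicators of `A` and `B` in the order `σ`. -/
def gap (σ : Equiv.Perm (Fin n)) (A B : Finset (Fin n)) (m : ℕ) : ℤ :=
  cycSum (indic σ A) m - cycSum (indic σ B) m

variable {σ : Equiv.Perm (Fin n)} {A B C : Finset (Fin n)}

lemma gap_add_gap (m : ℕ) : gap σ A B m + gap σ B C m = gap σ A C m := by
  simp [gap]

lemma gap_succ (m : ℕ) : gap σ A B (m + 1) =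
    gap σ A B m + (indic σ A (Fin.ofNat n m) - indic σ B (Fin.ofNat n m)) := by
  simp only [gap, cycSum_succ]; ring

lemma gap_mod (h : A.card = B.card) (m : ℕ) : gap σ A B m = gap σ A B (m % n) := by
  have hy : ∑ j, (indic σ A j - indic σ B j) = 0 := by
    rw [Finset.sum_sub_distrib, sum_indic_int, sum_indic_int, h, sub_self]
  obtain ⟨u, hu, hm⟩ := exists_fin_cycSum_eq hy m
  simpa [cycSum, Finset.sum_sub_distrib, gap, hm] using hu

lemma gap_add_period (h : A.card = B.card) (m : ℕ) : gap σ A B (m + n) = gap σ A B m := by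
  rw [gap_mod h, Nat.add_mod_right, ← gap_mod h]

lemma exists_mod_eq (t : Fin n) (p : ℕ) : ∃ m, p ≤ m ∧ m < p + n ∧ m % n = t := by
  have hn : 0 < n := Nat.pos_of_ne_zero (NeZero.ne n)
  have h := Nat.mod_lt p hn
  have h1 := Nat.div_add_mod p n
  have h2 := t.2
  rcases le_or_gt (p % n) t with h3 | h3
  · refine ⟨n * (p / n) + t, by omega, by omega, ?_⟩
    rw [Nat.mul_add_mod, Nat.mod_eq_of_lt h2]
  · refine ⟨n * (p / n) + n + t, by omega, by omega, ?_⟩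
    rw [add_assoc, Nat.mul_add_mod, Nat.add_mod_left, Nat.mod_eq_of_lt h2]

lemma exists_step_down {d : ℕ → ℤ} {a b : ℕ} (hab : a ≤ b) (h : d b < d a) :
    ∃ p, a ≤ p ∧ p < b ∧ d (p + 1) < d p := by
  by_contra hcon
  push Not at hcon
  have : ∀ m, a ≤ m → m ≤ b → d a ≤ d m := by
    intro m hm
    induction m, hm using Nat.le_induction with
    | base => exact fun _ => le_rfl
    | succ m hm ih => exact fun hmb => (ih (by omega)).trans (hcon m hm (by omega))
  exact absurd (this b hab le_rfl) (not_le.2 h)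

lemma mem_sdiff_of_gap_lt {p : ℕ} (h : gap σ A B (p + 1) < gap σ A B p) :
    σ (Fin.ofNat n p) ∈ B \ A := by
  rw [gap_succ] at h
  simp only [indic] at h
  rw [Finset.mem_sdiff]
  split_ifs at h <;> first | omega | exact ⟨by assumption, by assumption⟩

lemma gap_swap (m : ℕ) : gap σ B A m = - gap σ A B m := by simp [gap]

lemma cyclicallyOrdered_of_lt {p q r w : ℕ} (hpq : p < q) (hqr : q < r) (hrw : r < w)
    (hwp : w < p + n) : CyclicallyOrdered (Fin.ofNat n q) (Fin.ofNat n r) (Fin.ofNat n w)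
      (Fin.ofNat n p) := by
  have hn : 0 < n := Nat.pos_of_ne_zero (NeZero.ne n)
  have h := Nat.mod_lt p hn
  have h1 := Nat.div_add_mod p n
  have key : ∀ x, p ≤ x → x < p + n →
      (x % n = x - n * (p / n) ∧ x < n * (p / n) + n) ∨
      (x % n = x - n * (p / n) - n ∧ n * (p / n) + n ≤ x) := by
    intro x hx hx'
    obtain ⟨y, rfl⟩ : ∃ y, x = n * (p / n) + y := ⟨x - n * (p / n), by omega⟩
    rw [Nat.mul_add_mod]
    rcases lt_or_ge y n with hy | hy
    · left; rw [Nat.mod_eq_of_lt hy]; omega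
    · right; rw [Nat.mod_eq_sub_mod hy, Nat.mod_eq_of_lt (by omega)]; omega
  have kp := key p le_rfl (by omega)
  have kq := key q (by omega) (by omega)
  have kr := key r (by omega) (by omega)
  have kw := key w (by omega) (by omega)
  simp only [CyclicallyOrdered, Fin.lt_def, Fin.val_ofNat]
  generalize p % n = p' at *
  generalize q % n = q' at *
  generalize r % n = r' at *
  generalize w % n = w' at *
  generalize n * (p / n) = N at *
  omega

/-- High, low, high, low values of the gap force a down, up, down, up step between them. Down steps
lie in `B \ A` and up steps in `A \ B`, which is the forbidden cyclic pattern. -/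
lemma WeaklySeparated.not_alternating (h : WeaklySeparated σ A B) (hc : A.card = B.card)
    {t v s u : ℕ} (htv : t < v) (hvs : v < s) (hsu : s < u) (hut : u < t + n)
    (h1 : gap σ A B v < gap σ A B t) (h2 : gap σ A B v < gap σ A B s)
    (h3 : gap σ A B u < gap σ A B s) (h4 : gap σ A B u < gap σ A B t) : False := by
  obtain ⟨p, hp, hp', hpd⟩ := exists_step_down htv.le h1
  obtain ⟨q, hq, hq', hqd⟩ := exists_step_down (d := gap σ B A) hvs.le (by
    rw [gap_swap s, gap_swap v]; omega)
  obtain ⟨r, hr, hr', hrd⟩ := exists_step_down hsu.le h3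
  obtain ⟨w, hw, hw', hwd⟩ := exists_step_down (d := gap σ B A) hut.le (by
    rw [gap_swap (t + n), gap_swap u, gap_add_period hc]; omega)
  refine h _ (mem_sdiff_of_gap_lt hqd) _ (mem_sdiff_of_gap_lt hwd) _ (mem_sdiff_of_gap_lt hrd) _
    (mem_sdiff_of_gap_lt hpd) ?_
  simp only [Equiv.symm_apply_apply]
  exact cyclicallyOrdered_of_lt (by omega) (by omega) (by omega) (by omega)

/-- Combinatorial core of the exchange property. At each time the walk is nonnegative or lies inside
a `T`-interval whose left end was nonnegative. A descent opens such an interval, possibly after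
merging it by `hcross` with one already open; no interval extends past `hi`. -/
lemma walk_nonneg {d : ℕ → ℤ} {T : ℕ → ℕ → Prop} {lo hi : ℕ} (hlo : 0 ≤ d lo) (hlohi : lo ≤ hi)
    (hT : ∀ t s, T t s → lo ≤ t ∧ t < s ∧ s ≤ hi)
    (hmono : ∀ t s, T t s → d t ≤ d s)
    (hcross : ∀ t v s u, T t s → T v u → t < v → v < s → s < u → T t u ∨ T s u)
    (hcover : ∀ p, lo ≤ p → p < hi → d (p + 1) < d p → ∃ t s, T t s ∧ t ≤ p ∧ p < s) :
    0 ≤ d hi := by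
  have claim : ∀ p, lo ≤ p → p ≤ hi →
      0 ≤ d p ∨ ∃ t s, T t s ∧ t < p ∧ p < s ∧ 0 ≤ d t := by
    intro p
    induction p using Nat.strong_induction_on with
    | _ q ih =>
      intro hq hqhi
      rcases hq.eq_or_lt with rfl | hlt
      · exact Or.inl hlo
      obtain ⟨p, rfl⟩ : ∃ p, q = p + 1 := ⟨q - 1, by omega⟩
      have fin : ∀ t s, T t s → t < p + 1 → p + 1 ≤ s → 0 ≤ d t →
          0 ≤ d (p + 1) ∨ ∃ t s, T t s ∧ t < p + 1 ∧ p + 1 < s ∧ 0 ≤ d t := by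
        intro t s hts ht hs h0
        rcases hs.eq_or_lt with rfl | hs
        · exact Or.inl (h0.trans (hmono _ _ hts))
        · exact Or.inr ⟨t, s, hts, ht, hs, h0⟩
      rcases ih p (by omega) (by omega) (by omega) with h | ⟨t, s, hts, h1, h2, h3⟩
      · by_cases hstep : d (p + 1) < d p
        · obtain ⟨v, u, hvu, hv, hu⟩ := hcover p (by omega) (by omega) hstep
          by_cases hdv : 0 ≤ d v
          · exact fin v u hvu (by omega) (by omega) hdv
          · rcases ih v (by omega) (hT _ _ hvu).1 (by omega) with h' | ⟨t, s, hts, h1, h2, h3⟩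
            · exact absurd h' hdv
            rcases le_or_gt u s with hus | hsu
            · exact fin t s hts (by omega) (by omega) h3
            rcases hcross t v s u hts hvu h1 h2 hsu with htu | hsu'
            · exact fin t u htu (by omega) (by omega) h3
            · rcases le_or_gt (p + 1) s with hps | hsp
              · exact fin t s hts (by omega) hps h3
              · exact fin s u hsu' hsp (by omega) (h3.trans (hmono _ _ hts))
        · exact Or.inl (by omega)
      · exact fin t s hts (by omega) (by omega) h3
  rcases claim hi hlohi le_rfl with h | ⟨t, s, hts, -, h2, -⟩
  · exact h
  · exact absurd (hT _ _ hts).2.2 (by omega)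

variable {k : ℕ} {ι : Type*} {J : ι → Finset (Fin n)} {f : ι → Fin n}

lemma mem_cellBases : B ∈ cellBases k σ J f ↔
    B.card = k ∧ ∀ l, ∀ t : Fin n, gap σ B (J l) (f l) ≤ gap σ B (J l) t := by
  simp only [cellBases, cell, Set.mem_ofPred_eq, vertexVec_mem_hypersimplex, cycLevel_eq,
    cycSum_vertexVec, gap]
  refine and_congr_right fun _ => forall_congr' fun l => forall_congr' fun t => ?_
  exact_mod_cast Iff.rfl

lemma gap_le_of_mem_cellBases (hJ : ∀ l, (J l).card = k) (hB : B ∈ cellBases k σ J f) (l : ι)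
    (m : ℕ) : gap σ B (J l) (f l) ≤ gap σ B (J l) m := by
  have hn : 0 < n := Nat.pos_of_ne_zero (NeZero.ne n)
  have h := mem_cellBases.1 hB
  rw [gap_mod (by rw [h.1, hJ]) m]
  exact h.2 l ⟨m % n, Nat.mod_lt m hn⟩

lemma eq_of_window {p₀ m c : ℕ} (hm : p₀ ≤ m) (hm' : m < p₀ + n) (hc : p₀ ≤ c)
    (hc' : c < p₀ + n) (h : Fin.ofNat n m = Fin.ofNat n c) : m = c := by
  have h2 : m ≡ c [MOD n] := congrArg Fin.val h
  rcases le_total m c with h | h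
  · have := Nat.eq_zero_of_dvd_of_lt ((Nat.modEq_iff_dvd' h).1 h2) (by omega)
    omega
  · have := Nat.eq_zero_of_dvd_of_lt ((Nat.modEq_iff_dvd' h).1 h2.symm) (by omega)
    omega

/-- The effect of an exchange on partial sums, in a window of length `n`. -/
lemma gap_insert_erase {p₀ p q : ℕ} (ha : σ (Fin.ofNat n p) ∈ A) (hb : σ (Fin.ofNat n q) ∉ A)
    (hp : p₀ ≤ p) (hp' : p < p₀ + n) (hq : p₀ ≤ q) (hq' : q < p₀ + n) {m : ℕ}
    (hm : p₀ ≤ m) (hm' : m ≤ p₀ + n) :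
    gap σ (insert (σ (Fin.ofNat n q)) (A.erase (σ (Fin.ofNat n p)))) A m =
      gap σ (insert (σ (Fin.ofNat n q)) (A.erase (σ (Fin.ofNat n p)))) A p₀ +
        ((if q < m then 1 else 0) - if p < m then 1 else 0) := by
  induction m, hm using Nat.le_induction with
  | base => rw [if_neg (by omega), if_neg (by omega)]; ring
  | succ m hm ih =>
    have hinj : ∀ c, p₀ ≤ c → c < p₀ + n → σ (Fin.ofNat n m) = σ (Fin.ofNat n c) → m = c :=
      fun c hc hc' he => eq_of_window hm (by omega) hc hc' (σ.injective he)
    have hpq : σ (Fin.ofNat n q) ≠ σ (Fin.ofNat n p) := fun h => hb (h ▸ ha)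
    rw [gap_succ, ih (by omega)]
    by_cases hmq : m = q
    · subst hmq
      have hne : m ≠ p := fun h => hpq (by rw [h])
      have : p < m + 1 ↔ p < m := by omega
      simp [indic, hb, this, -Fin.ofNat_eq_cast]
      ring
    · have hmb : σ (Fin.ofNat n m) ≠ σ (Fin.ofNat n q) := fun h => hmq (hinj q hq hq' h)
      have hq1 : q < m + 1 ↔ q < m := by omega
      by_cases hmp : m = p
      · subst hmp
        simp [indic, hmb, ha, hq1, -Fin.ofNat_eq_cast]
        ring
      · have hma : σ (Fin.ofNat n m) ≠ σ (Fin.ofNat n p) := fun h => hmp (hinj p hp hp' h)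
        have hp1 : p < m + 1 ↔ p < m := by omega
        simp [indic, hmb, hma, hq1, hp1, -Fin.ofNat_eq_cast]

theorem cellBases_exchange (hJ : ∀ l, (J l).card = k)
    (hws : ∀ l l', WeaklySeparated σ (J l) (J l')) (hA : A ∈ cellBases k σ J f)
    (hB : B ∈ cellBases k σ J f) {a : Fin n} (ha : a ∈ A) (haB : a ∉ B) :
    ∃ b, b ∈ B ∧ b ∉ A ∧ insert b (A.erase a) ∈ cellBases k σ J f := by
  by_contra hcon
  push Not at hcon
  have hn : 0 < n := Nat.pos_of_ne_zero (NeZero.ne n)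
  have hAk := (mem_cellBases.1 hA).1
  have hBk := (mem_cellBases.1 hB).1
  obtain ⟨a₀, rfl⟩ : ∃ a₀ : ℕ, σ (Fin.ofNat n a₀) = a := ⟨σ.symm a, by simp⟩
  -- Both ends minimize the gap of `A` to the same `J l`, and the right end also minimizes that of
  -- `B`.
  let T : ℕ → ℕ → Prop := fun t s => ∃ l, a₀ + 1 ≤ t ∧ t < s ∧ s ≤ a₀ + n ∧
    gap σ A (J l) t = gap σ A (J l) s ∧ (∀ m, gap σ A (J l) s ≤ gap σ A (J l) m) ∧
    ∀ m, gap σ B (J l) s ≤ gap σ B (J l) m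
  have hdA : gap σ A B (a₀ + 1) = gap σ A B a₀ + 1 := by
    rw [gap_succ]; simp [indic, ha, haB, -Fin.ofNat_eq_cast]
  have hdn : gap σ A B (a₀ + n) = gap σ A B a₀ := gap_add_period (by rw [hAk, hBk]) _
  have := walk_nonneg (d := fun m => gap σ A B m - gap σ A B (a₀ + 1)) (T := T) (lo := a₀ + 1)
    (hi := a₀ + n) (by simp) (by omega) ?_ ?_ ?_ ?_
  · omega
  · rintro t s ⟨l, h1, h2, h3, -⟩
    exact ⟨h1, h2, h3⟩
  · rintro t s ⟨l, -, -, -, h4, h5, h6⟩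
    have e1 := gap_add_gap (σ := σ) (A := A) (B := B) (C := J l) t
    have e2 := gap_add_gap (σ := σ) (A := A) (B := B) (C := J l) s
    have e3 := h6 t
    omega
  · rintro t v s u ⟨l, h1, h2, h3, h4, h5, h6⟩ ⟨l', h1', h2', h3', h4', h5', h6'⟩ htv hvs hsu
    by_cases ht : gap σ A (J l') t = gap σ A (J l') u
    · exact Or.inl ⟨l', h1, by omega, h3', ht, h5', h6'⟩
    by_cases hs : gap σ A (J l') s = gap σ A (J l') u
    · exact Or.inr ⟨l', by omega, hsu, h3', hs, h5', h6'⟩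
    -- At `t` and `s` the gap from `J l` to `J l'` exceeds the difference of the two minima, while
    -- at `v` and `u` it does not: an alternation.
    exfalso
    have e := fun m => gap_add_gap (σ := σ) (A := A) (B := J l) (C := J l') m
    have e1 := e t
    have e2 := e v
    have e3 := e s
    have e4 := e u
    have i1 := h5' t
    have i2 := h5' s
    have i3 := h5 v
    have i4 := h5 u
    exact (hws l l').not_alternating (by rw [hJ, hJ]) htv hvs hsu (by omega) (by omega) (by omega)
      (by omega) (by omega)
  · intro p hp hpa hstep
    have hlt : gap σ A B (p + 1) < gap σ A B p := by simpa using hstep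
    have hb := Finset.mem_sdiff.1 (mem_sdiff_of_gap_lt hlt)
    have hnot := hcon _ hb.1 hb.2
    rw [mem_cellBases] at hnot
    push Not at hnot
    obtain ⟨l, t, hlt'⟩ := hnot (by rw [card_insert_erase ha hb.2, hAk])
    obtain ⟨t', ht1, ht2, ht3⟩ := exists_mod_eq t (a₀ + 1)
    obtain ⟨s, hs1, hs2, hs3⟩ := exists_mod_eq (f l) (a₀ + 1)
    have hcard : (insert (σ (Fin.ofNat n p)) (A.erase (σ (Fin.ofNat n a₀)))).card =
        (J l).card := by
      rw [card_insert_erase ha hb.2, hAk, hJ]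
    have hcardA : A.card = (J l).card := by rw [hAk, hJ]
    have hcardB : B.card = (J l).card := by rw [hBk, hJ]
    rw [← hs3, ← ht3, ← gap_mod hcard, ← gap_mod hcard, ← gap_add_gap (B := A),
      ← gap_add_gap (B := A) s,
      gap_insert_erase (p₀ := a₀) (m := t') ha hb.2 le_rfl (by omega) (by omega) hpa (by omega)
        (by omega),
      gap_insert_erase (p₀ := a₀) (m := s) ha hb.2 le_rfl (by omega) (by omega) hpa (by omega)
        (by omega)] at hlt'
    have hminA : ∀ m, gap σ A (J l) s ≤ gap σ A (J l) m := by
      intro m; rw [gap_mod hcardA s, hs3]; exact gap_le_of_mem_cellBases hJ hA l m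
    have hminB : ∀ m, gap σ B (J l) s ≤ gap σ B (J l) m := by
      intro m; rw [gap_mod hcardB s, hs3]; exact gap_le_of_mem_cellBases hJ hB l m
    have hmin := hminA t'
    -- Up to a constant, the exchange raises by one exactly the partial sums after `p` in the
    -- window. It can destroy the minimum at `s` only if `s` is raised while another minimizer `t'`
    -- is not.
    have hkey : t' ≤ p ∧ p < s ∧ gap σ A (J l) t' = gap σ A (J l) s := by
      split_ifs at hlt' <;> omega
    exact ⟨t', s, ⟨l, by omega, by omega, by omega, hkey.2.2, hminA, hminB⟩, hkey.1, hkey.2.1⟩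

theorem isMatroidPolytope_cell (hJ : ∀ l, (J l).card = k)
    (hws : ∀ l l', WeaklySeparated σ (J l) (J l'))
    (hne : (cell (fun l => cycLevel σ (J l)) (hypersimplex k n) f).Nonempty) :
    IsMatroidPolytope (cell (fun l => cycLevel σ (J l)) (hypersimplex k n) f) := by
  have hne' : ∃ B, B ∈ cellBases k σ J f := by
    rw [cell_eq_convexHull, convexHull_nonempty_iff] at hne
    obtain ⟨_, B, hB, -⟩ := hne
    exact ⟨B, hB⟩
  let M : Matroid (Fin n) := Matroid.ofIsBaseOfFinite (E := Set.univ) Set.finite_univ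
    (fun X => ∃ B ∈ cellBases k σ J f, (B : Set (Fin n)) = X)
    (by obtain ⟨B, hB⟩ := hne'; exact ⟨B, B, hB, rfl⟩)
    (by
      rintro _ _ ⟨A, hA, rfl⟩ ⟨B, hB, rfl⟩ a ⟨ha, haB⟩
      obtain ⟨b, hb, hbA, h⟩ := cellBases_exchange hJ hws hA hB (Finset.mem_coe.1 ha)
        (fun h => haB (Finset.mem_coe.2 h))
      exact ⟨b, ⟨hb, hbA⟩, _, h, by simp⟩)
    (fun _ _ => Set.subset_univ _)
  have hM : ∀ B : Finset (Fin n), M.IsBase (B : Set (Fin n)) ↔ B ∈ cellBases k σ J f := by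
    intro B
    change (∃ A ∈ cellBases k σ J f, (A : Set (Fin n)) = B) ↔ _
    simp only [Finset.coe_inj, exists_eq_right]
  refine ⟨M, rfl, ?_⟩
  rw [cell_eq_convexHull]
  congr 1
  ext x
  simp only [Set.mem_image, Set.mem_ofPred_eq, hM]
  constructor
  · rintro ⟨B, hB, rfl⟩; exact ⟨B, hB, rfl⟩
  · rintro ⟨B, hB, rfl⟩; exact ⟨B, hB, rfl⟩

end Exchange

/-! ### Matroid cells force weak separation -/

section Converse

variable {n k : ℕ} {σ : Equiv.Perm (Fin n)} {A B I I' : Finset (Fin n)}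

/-- The functional with coefficient `1` on `A` and `-1` off `A` is maximal among `0/1` vectors only
at that of `A`. Hence a matroid polytope determines its bases. -/
lemma mem_of_vertexVec_mem_convexHull {𝓑 : Set (Finset (Fin n))}
    (h : vertexVec A ∈ convexHull ℝ (vertexVec '' 𝓑)) : A ∈ 𝓑 := by
  by_contra hA
  let φ : (Fin n → ℝ) →ₗ[ℝ] ℝ := ∑ i, (if i ∈ A then (1 : ℝ) else -1) • LinearMap.proj i
  have hφ : ∀ C : Finset (Fin n), φ (vertexVec C) = (C ∩ A).card - (C \ A).card := by
    intro C
    simp only [φ, LinearMap.sum_apply, LinearMap.smul_apply, LinearMap.proj_apply, smul_eq_mul,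
      vertexVec]
    have h1 : ∀ i, (if i ∈ A then (1 : ℝ) else -1) * (if i ∈ C then 1 else 0) =
        (if i ∈ C ∩ A then 1 else 0) - if i ∈ C \ A then 1 else 0 := by
      intro i
      by_cases h1 : i ∈ A <;> by_cases h2 : i ∈ C <;> simp [h1, h2]
    simp only [h1, Finset.sum_sub_distrib]
    simp only [Finset.sum_ite_mem, Finset.univ_inter, Finset.sum_const, nsmul_eq_mul, mul_one]
  have hsub : convexHull ℝ (vertexVec '' 𝓑) ⊆ {x | φ x ≤ A.card - 1} := by
    refine convexHull_min ?_ (convex_halfSpace_le φ.isLinear _)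
    rintro _ ⟨C, hC, rfl⟩
    simp only [Set.mem_ofPred_eq, hφ]
    have hne : C ≠ A := fun h => hA (h ▸ hC)
    have hint : (C ∩ A).card ≤ A.card := Finset.card_le_card Finset.inter_subset_right
    by_cases hCA : C \ A = ∅
    · have hlt : (C ∩ A).card < A.card := by
        refine Finset.card_lt_card ⟨Finset.inter_subset_right, fun hAC => hne ?_⟩
        exact subset_antisymm (Finset.sdiff_eq_empty_iff_subset.1 hCA)
          (hAC.trans Finset.inter_subset_left)
      have : ((C ∩ A).card : ℝ) + 1 ≤ A.card := by exact_mod_cast hlt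
      rw [hCA]; simp; linarith
    · have h1 : 1 ≤ (C \ A).card := Finset.card_pos.2 (Finset.nonempty_iff_ne_empty.2 hCA)
      have h2 : (1 : ℝ) ≤ (C \ A).card := by exact_mod_cast h1
      have h3 : ((C ∩ A).card : ℝ) ≤ A.card := by exact_mod_cast hint
      linarith
  have := hsub h
  simp only [Set.mem_ofPred_eq, hφ] at this
  simp at this
  linarith

lemma exchange_of_isMatroidPolytope {ι : Type*} {J : ι → Finset (Fin n)} {f : ι → Fin n}
    (h : IsMatroidPolytope (cell (fun l => cycLevel σ (J l)) (hypersimplex k n) f))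
    (hA : A ∈ cellBases k σ J f) (hB : B ∈ cellBases k σ J f) {a : Fin n} (ha : a ∈ A)
    (haB : a ∉ B) : ∃ b, b ∈ B ∧ b ∉ A ∧ insert b (A.erase a) ∈ cellBases k σ J f := by
  obtain ⟨M, hME, hM⟩ := h
  have hset : {x | ∃ B : Finset (Fin n), M.IsBase (B : Set (Fin n)) ∧ x = vertexVec B} =
      vertexVec '' {B : Finset (Fin n) | M.IsBase (B : Set (Fin n))} := by
    ext x
    simp only [Set.mem_ofPred_eq, Set.mem_image]
    exact ⟨fun ⟨B, h1, h2⟩ => ⟨B, h1, h2.symm⟩, fun ⟨B, h1, h2⟩ => ⟨B, h1, h2.symm⟩⟩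
  rw [hset] at hM
  have hiff : ∀ C : Finset (Fin n), M.IsBase (C : Set (Fin n)) ↔ C ∈ cellBases k σ J f := by
    intro C
    constructor
    · intro hC
      change vertexVec C ∈ cell _ _ _
      rw [hM]
      exact subset_convexHull ℝ _ ⟨C, hC, rfl⟩
    · intro hC
      have hC' : vertexVec C ∈ cell (fun l => cycLevel σ (J l)) (hypersimplex k n) f := hC
      rw [hM] at hC'
      exact mem_of_vertexVec_mem_convexHull hC'
  obtain ⟨b, ⟨hb, hbA⟩, hbase⟩ := ((hiff A).2 hA).exchange ((hiff B).2 hB)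
    ⟨Finset.mem_coe.2 ha, fun h => haB (Finset.mem_coe.1 h)⟩
  refine ⟨b, hb, hbA, (hiff _).1 ?_⟩
  simpa using hbase

lemma exists_last {P : ℕ → Prop} {a b : ℕ} (hab : a ≤ b) (ha : P a) (hb : ¬ P b) :
    ∃ p, a ≤ p ∧ p < b ∧ P p ∧ ∀ m, p < m → m ≤ b → ¬ P m := by
  induction b, hab using Nat.le_induction with
  | base => exact absurd ha hb
  | succ b hab ih =>
    by_cases h : P b
    · refine ⟨b, hab, by omega, h, fun m h1 h2 => ?_⟩
      rwa [show m = b + 1 by omega]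
    · obtain ⟨p, h1, h2, h3, h4⟩ := ih h
      refine ⟨p, h1, by omega, h3, fun m h5 h6 => ?_⟩
      rcases h6.eq_or_lt with rfl | h6
      · exact hb
      · exact h4 m h5 (by omega)

lemma exists_first {P : ℕ → Prop} {a b : ℕ} (hab : a ≤ b) (ha : ¬ P a) (hb : P b) :
    ∃ p, a ≤ p ∧ p < b ∧ P (p + 1) ∧ ∀ m, a ≤ m → m ≤ p → ¬ P m := by
  classical
  have hex : ∃ m, a ≤ m ∧ P m := ⟨b, hab, hb⟩
  have h1 := Nat.find_spec hex
  have h2 : Nat.find hex ≠ a := fun h => ha (h ▸ h1.2)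
  have h3 : Nat.find hex ≤ b := Nat.find_min' hex ⟨hab, hb⟩
  refine ⟨Nat.find hex - 1, by omega, by omega, ?_, fun m h4 h5 h6 => ?_⟩
  · rw [show Nat.find hex - 1 + 1 = Nat.find hex by omega]; exact h1.2
  · have := Nat.find_min' hex ⟨h4, h6⟩
    omega

variable [NeZero n]

/-- Four crossing differences at a common level, in a window of length `n`. -/
structure LevelCrossing (D : ℕ → ℤ) (n a b c d : ℕ) (θ : ℤ) : Prop where
  hab : a < b
  hbc : b < c
  hcd : c < d
  hda : d < a + n
  at_a : D a = θ
  above_ab : ∀ m, a < m → m ≤ b → θ < D m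
  at_b : D (b + 1) = θ
  at_c : D c = θ
  above_cd : ∀ m, c < m → m ≤ d → θ < D m
  at_d : D (d + 1) = θ

lemma gap_step_le (m : ℕ) : gap σ I I' (m + 1) ≤ gap σ I I' m + 1 ∧
    gap σ I I' m ≤ gap σ I I' (m + 1) + 1 := by
  rw [gap_succ]
  simp only [indic]
  split_ifs <;> omega

lemma gap_succ_of_mem_sdiff {p : ℕ} (h : σ (Fin.ofNat n p) ∈ I \ I') :
    gap σ I I' (p + 1) = gap σ I I' p + 1 := by
  rw [Finset.mem_sdiff] at h
  rw [gap_succ]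
  simp [indic, h.1, h.2, -Fin.ofNat_eq_cast]

lemma exists_lifts {a b c d : Fin n} (h : CyclicallyOrdered a b c d) :
    ∃ p q r w : ℕ, Fin.ofNat n p = a ∧ Fin.ofNat n q = b ∧ Fin.ofNat n r = c ∧
      Fin.ofNat n w = d ∧ p < q ∧ q < r ∧ r < w ∧ w < p + n := by
  have h1 : ∀ x : Fin n, Fin.ofNat n x = x := fun x => by simp
  have h2 : ∀ x : Fin n, Fin.ofNat n (x + n) = x := fun x => by
    apply Fin.ext
    simp [Nat.mod_eq_of_lt x.2]
  have ha := a.2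
  have hb := b.2
  have hc := c.2
  have hd := d.2
  simp only [CyclicallyOrdered, Fin.lt_def] at h
  rcases h with h | h | h | h
  · exact ⟨a, b, c, d, h1 _, h1 _, h1 _, h1 _, by omega, by omega, by omega, by omega⟩
  · exact ⟨a, b + n, c + n, d + n, h1 _, h2 _, h2 _, h2 _, by omega, by omega, by omega, by omega⟩
  · exact ⟨a, b, c + n, d + n, h1 _, h1 _, h2 _, h2 _, by omega, by omega, by omega, by omega⟩
  · exact ⟨a, b, c, d + n, h1 _, h1 _, h1 _, h2 _, by omega, by omega, by omega, by omega⟩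

theorem exists_levelCrossing (hcard : I.card = I'.card) (h : ¬ WeaklySeparated σ I I') :
    ∃ a b c d θ, LevelCrossing (gap σ I I') n a b c d θ := by
  simp only [WeaklySeparated] at h
  push Not at h
  obtain ⟨i₁, hi₁, i₂, hi₂, j₁, hj₁, j₂, hj₂, hcyc⟩ := h
  obtain ⟨p, q, r, w, hp, hq, hr, hw, hpq, hqr, hrw, hwp⟩ := exists_lifts hcyc
  have hmem : ∀ {m : ℕ} {x : Fin n}, Fin.ofNat n m = σ.symm x → σ (Fin.ofNat n m) = x :=
    fun h => by rw [h, Equiv.apply_symm_apply]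
  set D := gap σ I I' with hD
  have hper : ∀ m, D (m + n) = D m := fun m => gap_add_period hcard m
  have dp : D (p + 1) = D p + 1 := gap_succ_of_mem_sdiff (by rw [hmem hp]; exact hi₁)
  have dr : D (r + 1) = D r + 1 := gap_succ_of_mem_sdiff (by rw [hmem hr]; exact hi₂)
  have dq : D (q + 1) = D q - 1 := by
    have := gap_succ_of_mem_sdiff (σ := σ) (I := I') (I' := I) (p := q) (by rw [hmem hq]; exact hj₁)
    rw [gap_swap, gap_swap q, ← hD] at this
    omega
  have dw : D (w + 1) = D w - 1 := by
    have := gap_succ_of_mem_sdiff (σ := σ) (I := I') (I' := I) (p := w) (by rw [hmem hw]; exact hj₂)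
    rw [gap_swap, gap_swap w, ← hD] at this
    omega
  have hne : ∀ {x y : ℕ}, x ≤ y → (Finset.Icc x y).Nonempty := fun h => Finset.nonempty_Icc.2 h
  obtain ⟨t₁, ht₁, m₁⟩ := Finset.exists_max_image (Finset.Icc (p + 1) q) D (hne (by omega))
  obtain ⟨t₂, ht₂, m₂⟩ := Finset.exists_min_image (Finset.Icc (q + 1) r) D (hne (by omega))
  obtain ⟨t₃, ht₃, m₃⟩ := Finset.exists_max_image (Finset.Icc (r + 1) w) D (hne (by omega))
  obtain ⟨t₄, ht₄, m₄⟩ := Finset.exists_min_image (Finset.Icc (w + 1) (p + n)) D (hne (by omega))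
  simp only [Finset.mem_Icc] at ht₁ ht₂ ht₃ ht₄ m₁ m₂ m₃ m₄
  have e1 := m₁ (p + 1) (by omega)
  have e2 := m₁ q (by omega)
  have e3 := m₂ (q + 1) (by omega)
  have e4 := m₂ r (by omega)
  have e5 := m₃ (r + 1) (by omega)
  have e6 := m₃ w (by omega)
  have e7 := m₄ (w + 1) (by omega)
  have e8 := m₄ (p + n) (by omega)
  rw [hper] at e8
  have e9 := hper t₁
  have e10 := hper t₂
  -- The higher of the two valleys still lies strictly below both peaks. Since the gap moves by at
  -- most one per step, the crossings nearest to the peaks have value exactly `θ`.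
  obtain ⟨θ, hθ⟩ : ∃ θ, θ = max (D t₂) (D t₄) := ⟨_, rfl⟩
  have l2 : D t₂ ≤ θ := hθ ▸ le_max_left _ _
  have l4 : D t₄ ≤ θ := hθ ▸ le_max_right _ _
  have l1 : ¬ D (t₁ + n) ≤ θ := by rw [hθ, le_max_iff]; omega
  have l3 : ¬ D t₃ ≤ θ := by rw [hθ, le_max_iff]; omega
  have l2' : D (t₂ + n) ≤ θ := by omega
  obtain ⟨a, a1, a2, a3, a4⟩ := exists_last (P := fun m => D m ≤ θ) (by omega : t₂ ≤ t₃) l2 l3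
  obtain ⟨b, b1, b2, b3, b4⟩ := exists_first (P := fun m => D m ≤ θ) (by omega : t₃ ≤ t₄) l3 l4
  obtain ⟨c, c1, c2, c3, c4⟩ := exists_last (P := fun m => D m ≤ θ) (by omega : t₄ ≤ t₁ + n) l4 l1
  obtain ⟨d, d1, d2, d3, d4⟩ := exists_first (P := fun m => D m ≤ θ)
    (by omega : t₁ + n ≤ t₂ + n) l1 l2'
  have sa : D (a + 1) ≤ D a + 1 := (gap_step_le a).1
  have sb : D b ≤ D (b + 1) + 1 := (gap_step_le b).2
  have sc : D (c + 1) ≤ D c + 1 := (gap_step_le c).1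
  have sd : D d ≤ D (d + 1) + 1 := (gap_step_le d).2
  have ua := a4 (a + 1) (by omega) (by omega)
  have ub := b4 b b1 le_rfl
  have uc := c4 (c + 1) (by omega) (by omega)
  have ud := d4 d d1 le_rfl
  refine ⟨a, b, c, d, θ, ⟨by omega, by omega, by omega, by omega, by omega, ?_, by omega, by omega,
    ?_, by omega⟩⟩
  · intro m h1 h2
    rcases le_or_gt m t₃ with h3 | h3
    · exact not_le.1 (a4 m h1 h3)
    · exact not_le.1 (b4 m h3.le h2)
  · intro m h1 h2
    rcases le_or_gt m (t₁ + n) with h3 | h3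
    · exact not_le.1 (c4 m h1 h3)
    · exact not_le.1 (d4 m h3.le h2)

/-- The set whose partial sums are the larger of those of `I` and of those of `I'` raised so as to
agree with `I` where the gap is `θ`. -/
def upperEnvelope (σ : Equiv.Perm (Fin n)) (I I' : Finset (Fin n)) (θ : ℤ) : Finset (Fin n) :=
  Finset.univ.filter fun i =>
    (θ ≤ gap σ I I' (σ.symm i) ∧ i ∈ I) ∨ (gap σ I I' (σ.symm i) ≤ θ ∧ i ∈ I')

lemma mem_upperEnvelope (hcard : I.card = I'.card) {θ : ℤ} {m : ℕ} :
    σ (Fin.ofNat n m) ∈ upperEnvelope σ I I' θ ↔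
      (θ ≤ gap σ I I' m ∧ σ (Fin.ofNat n m) ∈ I) ∨
        (gap σ I I' m ≤ θ ∧ σ (Fin.ofNat n m) ∈ I') := by
  have h : gap σ I I' ((σ.symm (σ (Fin.ofNat n m)) : Fin n) : ℕ) = gap σ I I' m := by
    rw [Equiv.symm_apply_apply, gap_mod hcard m]; simp
  simp only [upperEnvelope, Finset.mem_filter, Finset.mem_univ, true_and, h]

/-- Up to a constant, the gap to `I` vanishes where `gap σ I I'` is at least `θ` and is positive
elsewhere. This makes the minimizers for `I`, and likewise for `I'`, readable from the level `θ`. -/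
lemma gap_upperEnvelope (hcard : I.card = I'.card) (θ : ℤ) (m : ℕ) :
    gap σ (upperEnvelope σ I I' θ) I m =
      max 0 (θ - gap σ I I' m) - max 0 (θ - gap σ I I' 0) := by
  induction m with
  | zero => simp [gap]
  | succ m ih =>
    have h := mem_upperEnvelope (σ := σ) hcard (θ := θ) (m := m)
    have h2 := gap_succ (σ := σ) (A := I) (B := I') m
    rw [gap_succ, ih]
    simp only [indic, h] at h2 ⊢
    by_cases hI : σ (Fin.ofNat n m) ∈ I <;> by_cases hJ : σ (Fin.ofNat n m) ∈ I' <;>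
      simp only [hI, hJ, and_true, and_false, or_false, false_or, if_true, if_false] at h2 ⊢
    all_goals omega

lemma card_eq_of_gap_eq_zero (h : gap σ A B n = 0) : A.card = B.card := by
  rw [gap, cycSum_period, cycSum_period, sum_indic_int, sum_indic_int] at h
  omega

lemma card_upperEnvelope (hcard : I.card = I'.card) (θ : ℤ) :
    (upperEnvelope σ I I' θ).card = I.card := by
  apply card_eq_of_gap_eq_zero (σ := σ)
  rw [gap_upperEnvelope hcard, gap_mod hcard n, Nat.mod_self, sub_self]

variable {ι : Type*} {J : ι → Finset (Fin n)} {f : ι → Fin n}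

/-- The increments of `u` and `v` from `s` to `t` are integers that differ by at most one and have
nonnegative sum, so neither is negative. -/
lemma minimal_of_minimal_add {τ : Type*} {u v : τ → ℤ} {K : ℤ} {s : τ}
    (huv : ∀ t, u t - v t = K ∨ u t - v t = K + 1) (h : ∀ t, u s + v s ≤ u t + v t) (t : τ) :
    u s ≤ u t ∧ v s ≤ v t := by
  have h1 := huv s
  have h2 := huv t
  have h3 := h t
  omega

/-- When the partial sums of two sets differ by only two consecutive values, a cell containing their
midpoint contains both, since the levels of the midpoint are the averages. -/
lemma cellBases_of_midpoint (hA : A.card = k) (hB : B.card = k)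
    {p₀ : ℕ} {K : ℤ}
    (hAB : ∀ m, p₀ ≤ m → m < p₀ + n → gap σ A B m = K ∨ gap σ A B m = K + 1)
    (hmid : (1 / 2 : ℝ) • vertexVec A + (1 / 2 : ℝ) • vertexVec B ∈
      cell (fun l => cycLevel σ (J l)) (hypersimplex k n) f) :
    A ∈ cellBases k σ J f ∧ B ∈ cellBases k σ J f := by
  have hgap : ∀ t : Fin n, gap σ A B t = K ∨ gap σ A B t = K + 1 := by
    intro t
    obtain ⟨m, h1, h2, h3⟩ := exists_mod_eq t p₀
    rw [← h3, ← gap_mod (by rw [hA, hB])]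
    exact hAB m h1 h2
  have hlev : ∀ l (t : Fin n), cycLevel σ (J l) t
      ((1 / 2 : ℝ) • vertexVec A + (1 / 2 : ℝ) • vertexVec B) =
      ((gap σ A (J l) t + gap σ B (J l) t : ℤ) : ℝ) / 2 := by
    intro l t
    have h1 : ((1 / 2 : ℝ) • vertexVec A + (1 / 2 : ℝ) • vertexVec B) ∘ σ =
        (fun j => (1 / 2 : ℝ) * (vertexVec A ∘ σ) j + (1 / 2 : ℝ) * (vertexVec B ∘ σ) j) := rfl
    have h2 : cycSum (((1 / 2 : ℝ) • vertexVec A + (1 / 2 : ℝ) • vertexVec B) ∘ σ) t =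
        1 / 2 * cycSum (vertexVec A ∘ σ) t + 1 / 2 * cycSum (vertexVec B ∘ σ) t := by
      rw [h1]
      simp only [cycSum, Finset.sum_add_distrib, Finset.mul_sum]
    rw [cycLevel_eq, h2, cycSum_vertexVec, cycSum_vertexVec]
    simp only [gap]
    push_cast
    ring
  have key : ∀ l, ∀ t : Fin n, gap σ A (J l) (f l) ≤ gap σ A (J l) t ∧
      gap σ B (J l) (f l) ≤ gap σ B (J l) t := by
    intro l t
    refine minimal_of_minimal_add (τ := Fin n) (u := fun t => gap σ A (J l) t)
      (v := fun t => gap σ B (J l) t) (K := K) ?_ ?_ t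
    · intro t
      have := hgap t
      rw [← gap_add_gap (B := B)]
      omega
    · intro t
      have h := hmid.2 l t
      simp only [hlev] at h
      have h' : ((gap σ A (J l) (f l) + gap σ B (J l) (f l) : ℤ) : ℝ) ≤
          ((gap σ A (J l) t + gap σ B (J l) t : ℤ) : ℝ) := by linarith
      exact_mod_cast h'
  exact ⟨mem_cellBases.2 ⟨hA, fun l t => (key l t).1⟩, mem_cellBases.2 ⟨hB, fun l t => (key l t).2⟩⟩

lemma exists_window_minimizer (hJ : ∀ l, (J l).card = k) (l : ι) (p₀ : ℕ) :
    ∃ s, p₀ ≤ s ∧ s < p₀ + n ∧ ∀ C ∈ cellBases k σ J f, ∀ m,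
      gap σ C (J l) s ≤ gap σ C (J l) m := by
  obtain ⟨s, h1, h2, h3⟩ := exists_mod_eq (f l) p₀
  refine ⟨s, h1, h2, fun C hC m => ?_⟩
  rw [gap_mod (by rw [hJ, (mem_cellBases.1 hC).1]) s, h3]
  exact gap_le_of_mem_cellBases hJ hC l m

lemma insert_erase_eq {α : Type*} [DecidableEq α] {A B : Finset α} {a b c d : α} (ha : a ∈ A)
    (hb : b ∉ A) (hac : a ≠ c) (hbd : b ≠ d)
    (hB : ∀ x, x ∈ B ↔ x = d ∨ x = b ∨ (x ∈ A ∧ x ≠ a ∧ x ≠ c)) :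
    insert a (B.erase b) = insert d (A.erase c) := by
  ext x
  simp only [Finset.mem_insert, Finset.mem_erase, hB]
  grind

/-- In an exchange-closed family, two opposite vertices of an octahedron force a second pair. -/
lemma exists_opposite_pair {α : Type*} [DecidableEq α] {𝓑 : Set (Finset α)}
    (hex : ∀ A ∈ 𝓑, ∀ B ∈ 𝓑, ∀ a ∈ A, a ∉ B → ∃ b, b ∈ B ∧ b ∉ A ∧ insert b (A.erase a) ∈ 𝓑)
    {A B : Finset α} {a b c d : α} (ha : a ∈ A) (hc : c ∈ A) (hb : b ∉ A) (hd : d ∉ A)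
    (hac : a ≠ c) (hbd : b ≠ d)
    (hmemB : ∀ x, x ∈ B ↔ x = d ∨ x = b ∨ (x ∈ A ∧ x ≠ a ∧ x ≠ c))
    (hA : A ∈ 𝓑) (hB : B ∈ 𝓑) :
    (insert b (A.erase a) ∈ 𝓑 ∧ insert d (A.erase c) ∈ 𝓑) ∨
      (insert b (A.erase c) ∈ 𝓑 ∧ insert d (A.erase a) ∈ 𝓑) := by
  have hab' : a ≠ b := fun h => hb (h ▸ ha)
  have had' : a ≠ d := fun h => hd (h ▸ ha)
  have hcb' : c ≠ b := fun h => hb (h ▸ hc)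
  have hcd' : c ≠ d := fun h => hd (h ▸ hc)
  have haB : a ∉ B := by rw [hmemB]; tauto
  have hcB : c ∉ B := by rw [hmemB]; tauto
  have hbB : b ∈ B := by rw [hmemB]; tauto
  have hdB : d ∈ B := by rw [hmemB]; tauto
  have hBA : ∀ x, x ∈ B → x ∉ A → x = b ∨ x = d := by
    intro x hx hxA
    rw [hmemB] at hx; tauto
  have hAB' : ∀ x, x ∈ A → x ∉ B → x = a ∨ x = c := by
    intro x hx hxB
    rw [hmemB] at hxB; tauto
  have eq1 : insert a (B.erase b) = insert d (A.erase c) :=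
    insert_erase_eq ha hb hac hbd hmemB
  have eq2 : insert c (B.erase b) = insert d (A.erase a) :=
    insert_erase_eq hc hb hac.symm hbd fun x => (hmemB x).trans (by tauto)
  have eq3 : insert a (B.erase d) = insert b (A.erase c) :=
    insert_erase_eq ha hd hac hbd.symm fun x => (hmemB x).trans (by tauto)
  have eq4 : insert c (B.erase d) = insert b (A.erase a) :=
    insert_erase_eq hc hd hac.symm hbd.symm fun x => (hmemB x).trans (by tauto)
  have X : insert b (A.erase a) ∈ 𝓑 ∨ insert d (A.erase a) ∈ 𝓑 := by
    obtain ⟨x, hx, hxA, hX⟩ := hex A hA B hB a ha haB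
    rcases hBA x hx hxA with rfl | rfl <;> tauto
  have Y : insert b (A.erase c) ∈ 𝓑 ∨ insert d (A.erase c) ∈ 𝓑 := by
    obtain ⟨x, hx, hxA, hX⟩ := hex A hA B hB c hc hcB
    rcases hBA x hx hxA with rfl | rfl <;> tauto
  have Z : insert d (A.erase c) ∈ 𝓑 ∨ insert d (A.erase a) ∈ 𝓑 := by
    obtain ⟨x, hx, hxA, hX⟩ := hex B hB A hA b hbB hb
    rcases hAB' x hx hxA with rfl | rfl
    · exact Or.inl (eq1 ▸ hX)
    · exact Or.inr (eq2 ▸ hX)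
  have W : insert b (A.erase c) ∈ 𝓑 ∨ insert b (A.erase a) ∈ 𝓑 := by
    obtain ⟨x, hx, hxA, hX⟩ := hex B hB A hA d hdB hd
    rcases hAB' x hx hxA with rfl | rfl
    · exact Or.inl (eq3 ▸ hX)
    · exact Or.inr (eq4 ▸ hX)
  tauto

/-- Some cell around the centre of an octahedron contains two opposite vertices and a second
such pair. -/
lemma exists_cell_opposite_pair
    (hcell : ∀ x ∈ hypersimplex k n, ∃ f,
      x ∈ cell (fun l => cycLevel σ (J l)) (hypersimplex k n) f ∧
      IsMatroidPolytope (cell (fun l => cycLevel σ (J l)) (hypersimplex k n) f))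
    (hAk : A.card = k) {a b c d : ℕ} (hab : a < b) (hbc : b < c) (hcd : c < d) (hda : d < a + n)
    (haA : σ (Fin.ofNat n a) ∈ A) (hcA : σ (Fin.ofNat n c) ∈ A) (hbA : σ (Fin.ofNat n b) ∉ A)
    (hdA : σ (Fin.ofNat n d) ∉ A) :
    ∃ f, A ∈ cellBases k σ J f ∧
      ((insert (σ (Fin.ofNat n b)) (A.erase (σ (Fin.ofNat n a))) ∈ cellBases k σ J f ∧
        insert (σ (Fin.ofNat n d)) (A.erase (σ (Fin.ofNat n c))) ∈ cellBases k σ J f) ∨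
      (insert (σ (Fin.ofNat n b)) (A.erase (σ (Fin.ofNat n c))) ∈ cellBases k σ J f ∧
        insert (σ (Fin.ofNat n d)) (A.erase (σ (Fin.ofNat n a))) ∈ cellBases k σ J f)) := by
  have hac : σ (Fin.ofNat n a) ≠ σ (Fin.ofNat n c) := fun h => by
    have := eq_of_window (p₀ := a) le_rfl (by omega) (by omega) (by omega) (σ.injective h)
    omega
  have hbd : σ (Fin.ofNat n b) ≠ σ (Fin.ofNat n d) := fun h => by
    have := eq_of_window (p₀ := a) (by omega) (by omega) (by omega) (by omega) (σ.injective h)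
    omega
  have gab := fun m (h1 : a ≤ m) (h2 : m ≤ a + n) => gap_insert_erase (p₀ := a) (m := m) haA hbA
    le_rfl (by omega) (by omega) (by omega) h1 h2
  have hA₁k := card_insert_erase haA hbA
  obtain ⟨A₁, hA₁⟩ : ∃ A₁, A₁ = insert (σ (Fin.ofNat n b)) (A.erase (σ (Fin.ofNat n a))) := ⟨_, rfl⟩
  rw [← hA₁] at gab hA₁k
  have hcA' : σ (Fin.ofNat n c) ∈ A₁ :=
    hA₁ ▸ Finset.mem_insert_of_mem (Finset.mem_erase.2 ⟨hac.symm, hcA⟩)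
  have hdA' : σ (Fin.ofNat n d) ∉ A₁ := by
    rw [hA₁, Finset.mem_insert, not_or]
    exact ⟨hbd.symm, fun h => hdA (Finset.mem_of_mem_erase h)⟩
  have gB := fun m (h1 : a ≤ m) (h2 : m ≤ a + n) => gap_insert_erase (p₀ := a) (m := m) hcA' hdA'
    (by omega) (by omega) (by omega) (by omega) h1 h2
  have hBk := card_insert_erase hcA' hdA'
  obtain ⟨B, hBdef⟩ : ∃ B, B = insert (σ (Fin.ofNat n d)) (A₁.erase (σ (Fin.ofNat n c))) :=
    ⟨_, rfl⟩
  rw [← hBdef] at gB hBk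
  have hBk' : B.card = k := by omega
  -- Passing from `A` to its antipode lowers the partial sums by one on `(a, b]` and on `(c, d]`, up
  -- to a constant; these intervals are disjoint, so only two values occur.
  have hAB : ∀ m, a + 1 ≤ m → m < a + 1 + n →
      gap σ A B m = (-gap σ B A₁ a - gap σ A₁ A a) ∨
      gap σ A B m = (-gap σ B A₁ a - gap σ A₁ A a) + 1 := by
    intro m h1 h2
    have h3 := gB m (by omega) (by omega)
    have h4 := gab m (by omega) (by omega)
    have h5 := gap_add_gap (σ := σ) (A := B) (B := A₁) (C := A) m
    have h6 := gap_swap (σ := σ) (A := B) (B := A) m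
    split_ifs at h3 h4 <;> omega
  have hmidΔ : (1 / 2 : ℝ) • vertexVec A + (1 / 2 : ℝ) • vertexVec B ∈ hypersimplex k n :=
    convex_hypersimplex k n (vertexVec_mem_hypersimplex.2 hAk) (vertexVec_mem_hypersimplex.2 hBk')
      (by norm_num) (by norm_num) (by norm_num)
  obtain ⟨f, hf, hM⟩ := hcell _ hmidΔ
  obtain ⟨hA, hB⟩ := cellBases_of_midpoint hAk hBk' hAB hf
  refine ⟨f, hA, exists_opposite_pair (fun A hA B hB a ha haB =>
    exchange_of_isMatroidPolytope hM hA hB ha haB) haA hcA hbA hdA hac hbd ?_ hA hB⟩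
  intro x
  have hne : σ (Fin.ofNat n b) ≠ σ (Fin.ofNat n c) := fun h => hbA (h ▸ hcA)
  simp only [hBdef, hA₁, Finset.mem_insert, Finset.mem_erase]
  constructor
  · rintro (h | ⟨h1, h | h⟩)
    · exact Or.inl h
    · exact Or.inr (Or.inl h)
    · exact Or.inr (Or.inr ⟨h.2, h.1, h1⟩)
  · rintro (h | h | h)
    · exact Or.inl h
    · exact Or.inr ⟨fun h' => hne (h.symm.trans h'), Or.inl h⟩
    · exact Or.inr ⟨h.2.2, Or.inr ⟨h.2.1, h.1⟩⟩

lemma mem_upperEnvelope_of_up (hcard : I.card = I'.card) {θ : ℤ} {m : ℕ}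
    (h1 : gap σ I I' m = θ) (h2 : θ < gap σ I I' (m + 1)) :
    σ (Fin.ofNat n m) ∈ upperEnvelope σ I I' θ := by
  rw [mem_upperEnvelope hcard]
  refine Or.inl ⟨h1.ge, ?_⟩
  by_contra hcon
  rw [gap_succ] at h2
  simp only [indic, hcon, if_false] at h2
  split_ifs at h2 <;> omega

lemma notMem_upperEnvelope_of_down (hcard : I.card = I'.card) {θ : ℤ} {m : ℕ}
    (h1 : θ < gap σ I I' m) (h2 : gap σ I I' (m + 1) = θ) :
    σ (Fin.ofNat n m) ∉ upperEnvelope σ I I' θ := by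
  rw [mem_upperEnvelope hcard]
  rintro (⟨-, hcon⟩ | ⟨hcon, -⟩)
  · rw [gap_succ] at h2
    simp only [indic, hcon, if_true] at h2
    split_ifs at h2 <;> omega
  · omega

/-- In an octahedron that two blades split in different ways, no cell around the centre has the
exchange property. -/
lemma false_of_levelCrossing (hJ : ∀ l, (J l).card = k) {l l' : ι} {a b c d : ℕ} {θ : ℤ}
    (h : LevelCrossing (gap σ (J l) (J l')) n a b c d θ)
    (hcell : ∀ x ∈ hypersimplex k n, ∃ f,
      x ∈ cell (fun l => cycLevel σ (J l)) (hypersimplex k n) f ∧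
      IsMatroidPolytope (cell (fun l => cycLevel σ (J l)) (hypersimplex k n) f)) : False := by
  obtain ⟨hab, hbc, hcd, hda, at_a, above_ab, at_b, at_c, above_cd, at_d⟩ := h
  have hcard : (J l).card = (J l').card := by rw [hJ, hJ]
  have sa := above_ab (a + 1) (by omega) (by omega)
  have sc := above_cd (c + 1) (by omega) (by omega)
  have haA := mem_upperEnvelope_of_up hcard at_a sa
  have hcA := mem_upperEnvelope_of_up hcard at_c sc
  have hbA := notMem_upperEnvelope_of_down hcard (above_ab b (by omega) (by omega)) at_b
  have hdA := notMem_upperEnvelope_of_down hcard (above_cd d (by omega) (by omega)) at_d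
  have hAk : (upperEnvelope σ (J l) (J l') θ).card = k := by rw [card_upperEnvelope hcard, hJ]
  have hAI := gap_upperEnvelope (σ := σ) hcard θ
  have hAJ : ∀ m, gap σ (upperEnvelope σ (J l) (J l') θ) (J l') m =
      max 0 (θ - gap σ (J l) (J l') m) - max 0 (θ - gap σ (J l) (J l') 0) +
        gap σ (J l) (J l') m := fun m => by
    rw [← hAI, gap_add_gap]
  generalize upperEnvelope σ (J l) (J l') θ = A at *
  generalize gap σ (J l) (J l') = D at *
  obtain ⟨f, hA, hor⟩ := exists_cell_opposite_pair hcell hAk hab hbc hcd hda haA hcA hbA hdA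
  rcases hor with ⟨h1, h2⟩ | ⟨h1, h2⟩
  -- For `J l`, the exchange of `a` for `b` lowers the gap on `(a, b]` only and that of `c` for `d`
  -- on `(c, d]` only. The common minimizer `s` would have to lie in both.
  · obtain ⟨s, hs1, hs2, hs⟩ := exists_window_minimizer (σ := σ) (f := f) hJ l (a + 1)
    have i1 := hs _ h1 (a + 1)
    have i2 := hs _ h2 (c + 1)
    have i3 := hs _ hA a
    have g := fun m (h1 : a ≤ m) (h2 : m ≤ a + n) => gap_insert_erase (p₀ := a) (m := m) haA hbA
      le_rfl (by omega) (by omega) (by omega) h1 h2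
    have g' := fun m (h1 : a ≤ m) (h2 : m ≤ a + n) => gap_insert_erase (p₀ := a) (m := m) hcA hdA
      (by omega) (by omega) (by omega) (by omega) h1 h2
    rw [← gap_add_gap (B := A), ← gap_add_gap (B := A) (a + 1), g s (by omega) (by omega),
      g (a + 1) (by omega) (by omega), hAI, hAI] at i1
    rw [← gap_add_gap (B := A), ← gap_add_gap (B := A) (c + 1), g' s (by omega) (by omega),
      g' (c + 1) (by omega) (by omega), hAI, hAI] at i2
    rw [hAI, hAI] at i3
    have m1 : max 0 (θ - D (a + 1)) = 0 := by omega
    have m2 : max 0 (θ - D (c + 1)) = 0 := by omega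
    have m3 : max 0 (θ - D a) = 0 := by omega
    have m4 : 0 ≤ max 0 (θ - D s) := le_max_left _ _
    rw [m1] at i1
    rw [m2] at i2
    rw [m3] at i3
    clear g g' hAI hAJ above_ab above_cd hs
    generalize max 0 (θ - D s) = M at *
    generalize max 0 (θ - D 0) = M₀ at *
    rw [if_neg (by omega : ¬ b < a + 1), if_pos (by omega : a < a + 1),
      if_pos (by omega : a < s)] at i1
    rw [if_neg (by omega : ¬ d < c + 1), if_pos (by omega : c < c + 1)] at i2
    split_ifs at i1 i2 <;> omega
  -- For `J l'`, the gap of the envelope is `max θ (D m)` up to a constant, so its minimizer `s`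
  -- avoids `(a, b]` and `(c, d]`. Exchanging `c` for `b` raises `(b, c]`, and exchanging `a` for
  -- `d` lowers `(a, d]`, leaving no place for `s`.
  · obtain ⟨s, hs1, hs2, hs⟩ := exists_window_minimizer (σ := σ) (f := f) hJ l' (a + 1)
    have i1 := hs _ h1 (d + 1)
    have i2 := hs _ h2 (b + 1)
    have i3 := hs _ hA a
    have g := fun m (h1 : a ≤ m) (h2 : m ≤ a + n) => gap_insert_erase (p₀ := a) (m := m) hcA hbA
      (by omega) (by omega) (by omega) (by omega) h1 h2
    have g' := fun m (h1 : a ≤ m) (h2 : m ≤ a + n) => gap_insert_erase (p₀ := a) (m := m) haA hdA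
      le_rfl (by omega) (by omega) (by omega) h1 h2
    rw [← gap_add_gap (B := A), ← gap_add_gap (B := A) (d + 1), g s (by omega) (by omega),
      g (d + 1) (by omega) (by omega), hAJ, hAJ] at i1
    rw [← gap_add_gap (B := A), ← gap_add_gap (B := A) (b + 1), g' s (by omega) (by omega),
      g' (b + 1) (by omega) (by omega), hAJ, hAJ] at i2
    rw [hAJ, hAJ] at i3
    have u1 := above_ab s (by omega)
    have u2 : c < s → s ≤ d → θ < D s := above_cd s
    have m1 : max 0 (θ - D (d + 1)) = 0 := by omega
    have m2 : max 0 (θ - D (b + 1)) = 0 := by omega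
    have m3 : max 0 (θ - D a) = 0 := by omega
    have m4 : 0 ≤ max 0 (θ - D s) := le_max_left _ _
    have m5 : θ - D s ≤ max 0 (θ - D s) := le_max_right _ _
    rw [m1] at i1
    rw [m2] at i2
    rw [m3] at i3
    clear g g' hAI hAJ above_ab above_cd hs
    generalize max 0 (θ - D s) = M at *
    generalize max 0 (θ - D 0) = M₀ at *
    rw [if_pos (by omega : b < d + 1), if_pos (by omega : c < d + 1)] at i1
    rw [if_neg (by omega : ¬ d < b + 1), if_pos (by omega : a < b + 1),
      if_pos (by omega : a < s)] at i2
    split_ifs at i1 i2 <;> omega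

theorem weaklySeparated_of_isMatroidPolytope (hJ : ∀ l, (J l).card = k)
    (hcell : ∀ x ∈ hypersimplex k n, ∃ f,
      x ∈ cell (fun l => cycLevel σ (J l)) (hypersimplex k n) f ∧
      IsMatroidPolytope (cell (fun l => cycLevel σ (J l)) (hypersimplex k n) f)) (l l' : ι) :
    WeaklySeparated σ (J l) (J l') := by
  by_contra h
  obtain ⟨a, b, c, d, θ, hcross⟩ := exists_levelCrossing (by rw [hJ, hJ]) h
  exact false_of_levelCrossing hJ hcross hcell

end Converse

/-! ### Matroid subdivisions and weak separation -/

section Main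

variable {n k : ℕ}

lemma mem_walls_iff {ι τ : Type*} {g : ι → τ → (Fin n → ℝ) →ᵃ[ℝ] ℝ} {x : Fin n → ℝ} :
    x ∈ walls g ↔ ∃ i, x ∈ walls fun _ : Unit => g i := by
  simp [walls]

lemma WeaklySeparated.refl (σ : Equiv.Perm (Fin n)) (I : Finset (Fin n)) :
    WeaklySeparated σ I I := by
  intro i hi
  simp at hi

lemma WeaklySeparated.symm {σ : Equiv.Perm (Fin n)} {I J : Finset (Fin n)}
    (h : WeaklySeparated σ I J) : WeaklySeparated σ J I := by
  intro i₁ hi₁ i₂ hi₂ j₁ hj₁ j₂ hj₂ hc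
  refine h j₁ hj₁ j₂ hj₂ i₂ hi₂ i₁ hi₁ ?_
  simp only [CyclicallyOrdered] at hc ⊢
  tauto

lemma IsDecoratedOSP.isOrderedPartition {ℓ : ℕ} {S : Fin ℓ → Finset (Fin n)} {s : Fin ℓ → ℤ}
    (h : IsDecoratedOSP k S s) : IsOrderedPartition S where
  disjoint := h.1
  cover := h.2.1
  nonempty j := by
    have := h.2.2.2 j
    rw [← Finset.card_pos]
    omega

lemma cycLevel_ne_of_generic (σ : Equiv.Perm (Fin n)) (J : Finset (Fin n)) {y : Fin n → ℝ}
    (hy : ∀ D : Finset (Fin n), D.Nonempty → D ≠ Finset.univ → ∀ m : ℤ, ∑ i ∈ D, y i ≠ m) :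
    ∀ t u, t ≠ u → cycLevel σ J t y ≠ cycLevel σ J u y :=
  level_ne_of_generic (isOrderedPartition_singleton σ) _ hy

variable [NeZero n]

/-- Indexed families let a collection of sets and the pair of a common refinement be treated alike,
even when the two sets of the pair coincide. -/
theorem isMatroidSubdivision_fullCells_iff {ι : Type*} [Finite ι] (hk : 1 ≤ k) (hkn : k + 1 ≤ n)
    (σ : Equiv.Perm (Fin n)) {J : ι → Finset (Fin n)} (hJ : ∀ l, (J l).card = k) :
    IsMatroidSubdivision (hypersimplex k n)
        (fullCells (fun l => cycLevel σ (J l)) (hypersimplex k n)) ↔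
      ∀ l l', WeaklySeparated σ (J l) (J l') := by
  obtain ⟨y, hyU, hy⟩ := exists_generic_point hk hkn
  have hyQ := openHypersimplex_subset hyU
  have hgen := fun l => cycLevel_ne_of_generic σ (J l) hy
  constructor
  · rintro ⟨-, hM⟩
    refine weaklySeparated_of_isMatroidPolytope hJ fun x hx => ?_
    rw [← sUnion_fullCells (g := fun l => cycLevel σ (J l)) (isClosed_hypersimplex k n)
      (convex_hypersimplex k n) hyQ hgen] at hx
    obtain ⟨P, ⟨f, hf, rfl⟩, hxP⟩ := hx
    exact ⟨f, hxP, hM _ ⟨f, hf, rfl⟩⟩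
  · intro hws
    refine ⟨isPolytopalSubdivision_fullCells (isClosed_hypersimplex k n)
      (convex_hypersimplex k n) hyQ hgen fun f => ?_, ?_⟩
    · exact ⟨_, (Set.toFinite (cellBases k σ J f)).image _, cell_eq_convexHull⟩
    · rintro P ⟨f, hf, rfl⟩
      exact isMatroidPolytope_cell hJ hws (hf.mono openCell_subset_cell)

/-! ### Positroid cells -/

lemma sum_cyclicInterval (x : Fin n → ℝ) (i : Fin n) {m : ℕ} (hm : 1 ≤ m) (hmn : m < n) :
    ∑ j ∈ cyclicInterval i m, x j = cycSum x (i + m) - cycSum x i := by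
  have h := sum_Iic_rotate x i ⟨m - 1, by omega⟩
  rw [show (i : ℕ) + ((⟨m - 1, by omega⟩ : Fin n) : ℕ) + 1 = i + m by simp only; omega] at h
  rw [← h]
  refine Finset.sum_bij (fun j _ => j - i) ?_ ?_ ?_ ?_
  · intro j hj
    have hj' : ((j - i : Fin n) : ℕ) < m := by simpa [cyclicInterval] using hj
    rw [Finset.mem_Iic, Fin.le_def]
    simp only
    omega
  · intro a _ b _ hab
    exact sub_left_injective hab
  · intro b hb
    rw [Finset.mem_Iic, Fin.le_def] at hb
    simp only at hb
    refine ⟨b + i, ?_, by simp⟩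
    simp only [cyclicInterval, Finset.mem_filter, Finset.mem_univ, true_and, add_sub_cancel_right]
    omega
  · intro j _
    simp

/-- A level difference is an interval sum up to an integer. -/
lemma exists_cycLevel_sub_eq (I : Finset (Fin n)) (hI : I.card = k) {t i : Fin n} (hti : t ≠ i) :
    ∃ (m : ℕ) (z : ℤ), 1 ≤ m ∧ m < n ∧ ∀ x : Fin n → ℝ, ∑ j, x j = (k : ℝ) →
      cycLevel (Equiv.refl _) I t x - cycLevel (Equiv.refl _) I i x =
        ∑ j ∈ cyclicInterval i m, x j - z := by
  have hne : (t : ℕ) ≠ i := fun h => hti (Fin.ext h)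
  have ht := t.2
  have hi := i.2
  obtain ⟨m, hm, hmn, hcase⟩ : ∃ m, 1 ≤ m ∧ m < n ∧ ((i : ℕ) + m = t ∨ (i : ℕ) + m = t + n) := by
    rcases lt_or_gt_of_ne hne with h | h
    · exact ⟨t + n - i, by omega, by omega, by omega⟩
    · exact ⟨t - i, by omega, by omega, by omega⟩
  refine ⟨m, cycSum (indic (Equiv.refl _) I) (i + m) - cycSum (indic (Equiv.refl _) I) i, hm, hmn,
    fun x hx => ?_⟩
  rw [sum_cyclicInterval x i hm hmn, cycLevel_eq, cycLevel_eq]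
  have hcomp : x ∘ (Equiv.refl (Fin n)) = x := rfl
  rw [hcomp]
  rcases hcase with h | h
  · rw [h]; push_cast; ring
  · rw [h, cycSum_add_period, cycSum_add_period, hx, sum_indic_int, hI]
    push_cast; ring

/-- Take for each cyclic interval the greatest integer lower bound valid on the cell. Every
inequality defining the cell is an integer lower bound on some interval: `x j ≤ 1` becomes one on
the complement of `j`, and a level inequality is one by `exists_cycLevel_sub_eq`. -/
theorem isPositroid_cut {ι : Type*} (hkn : k + 1 ≤ n) (hk : 1 ≤ k) {J : ι → Finset (Fin n)}
    (hJ : ∀ l, (J l).card = k) {f : ι → Fin n}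
    (hne : (cell (fun l => cycLevel (Equiv.refl _) (J l)) (hypersimplex k n) f).Nonempty) :
    ∃ r : Fin n → ℕ → ℤ, cell (fun l => cycLevel (Equiv.refl _) (J l)) (hypersimplex k n) f =
      {x | ∑ i, x i = (k : ℝ) ∧
        ∀ i : Fin n, ∀ m : ℕ, 1 ≤ m → m < n → (r i m : ℝ) ≤ ∑ j ∈ cyclicInterval i m, x j} := by
  set P := cell (fun l => cycLevel (Equiv.refl _) (J l)) (hypersimplex k n) f with hP
  have hex : ∀ (i : Fin n) (m : ℕ), ∃ r : ℤ,
      (∀ x ∈ P, (r : ℝ) ≤ ∑ j ∈ cyclicInterval i m, x j) ∧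
      ∀ z : ℤ, (∀ x ∈ P, (z : ℝ) ≤ ∑ j ∈ cyclicInterval i m, x j) → z ≤ r := by
    intro i m
    obtain ⟨x₀, hx₀⟩ := hne
    refine Int.exists_greatest_of_bdd
      (P := fun r : ℤ => ∀ x ∈ P, (r : ℝ) ≤ ∑ j ∈ cyclicInterval i m, x j)
      ⟨⌊∑ j ∈ cyclicInterval i m, x₀ j⌋, fun z hz => Int.le_floor.2 (hz x₀ hx₀)⟩
      ⟨0, fun x hx => ?_⟩
    rw [Int.cast_zero]
    exact Finset.sum_nonneg fun j _ => (hx.1.1 j).1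
  choose r hr hmax using hex
  refine ⟨r, Set.ext fun x => ⟨fun hx => ⟨hx.1.2, fun i m _ _ => hr i m x hx⟩, ?_⟩⟩
  rintro ⟨hsum, hx⟩
  have key : ∀ i m (z : ℤ), 1 ≤ m → m < n →
      (∀ x ∈ P, (z : ℝ) ≤ ∑ j ∈ cyclicInterval i m, x j) →
      (z : ℝ) ≤ ∑ j ∈ cyclicInterval i m, x j := by
    intro i m z h1 h2 h
    exact (Int.cast_le.2 (hmax i m z h)).trans (hx i m h1 h2)
  have hsingle : ∀ (y : Fin n → ℝ) j, ∑ a ∈ cyclicInterval j 1, y a = y j := by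
    intro y j
    rw [sum_cyclicInterval y j le_rfl (by omega), cycSum_succ]
    simp
  have hcompl : ∀ (y : Fin n → ℝ) (j : Fin n),
      ∑ a ∈ cyclicInterval (Fin.ofNat n (j + 1)) (n - 1), y a = ∑ a, y a - y j := by
    intro y j
    rw [sum_cyclicInterval y _ (by omega) (by omega)]
    have hsucc : cycSum y (j + 1) = cycSum y j + y j := by
      rw [cycSum_succ]; simp
    have hj := j.2
    rcases (by omega : (j : ℕ) + 1 < n ∨ (j : ℕ) + 1 = n) with h | h
    · have hv : ((Fin.ofNat n (j + 1) : Fin n) : ℕ) = j + 1 := Nat.mod_eq_of_lt h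
      rw [hv, show (j : ℕ) + 1 + (n - 1) = j + n by omega, cycSum_add_period, hsucc]
      ring
    · have hv : ((Fin.ofNat n (j + 1) : Fin n) : ℕ) = 0 := by
        rw [Fin.val_ofNat, h, Nat.mod_self]
      rw [h, cycSum_period] at hsucc
      rw [hv, show 0 + (n - 1) = (j : ℕ) by omega, cycSum_zero]
      linarith
  refine ⟨⟨fun j => ⟨?_, ?_⟩, hsum⟩, fun l t => ?_⟩
  · have := key j 1 0 le_rfl (by omega) fun y hy => by
      rw [hsingle]; simpa using (hy.1.1 j).1
    rw [hsingle] at this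
    simpa using this
  · have := key (Fin.ofNat n (j + 1)) (n - 1) (k - 1) (by omega) (by omega) fun y hy => by
      rw [hcompl, hy.1.2]
      have := (hy.1.1 j).2
      push_cast; linarith
    rw [hcompl, hsum] at this
    push_cast at this
    linarith
  · by_cases ht : t = f l
    · rw [ht]
    obtain ⟨m, z, hm, hmn, hz⟩ := exists_cycLevel_sub_eq (J l) (hJ l) ht
    have h1 := key (f l) m z hm hmn fun y hy => by
      have h2 := hz y hy.1.2
      have h3 := hy.2 l t
      linarith
    have h2 := hz x hsum
    linarith

theorem chambers_bladeArrangement (hk : 1 ≤ k) (hkn : k + 1 ≤ n) (σ : Equiv.Perm (Fin n))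
    (𝒞 : Finset (Finset (Fin n))) (h𝒞 : ∀ I ∈ 𝒞, I.card = k) :
    chambers (hypersimplex k n) (bladeArrangement σ 𝒞) =
      fullCells (fun I : 𝒞 => cycLevel σ I.1) (hypersimplex k n) := by
  obtain ⟨y, hyU, -⟩ := exists_generic_point hk hkn
  refine chambers_eq_fullCells (isClosed_hypersimplex k n) subset_rfl
    ⟨y, openHypersimplex_subset hyU⟩ (lineMap_mem_of_convex (convex_hypersimplex k n))
    (convex_hypersimplex k n) fun x hx => ?_
  rw [mem_walls_iff]
  simp only [bladeArrangement, Set.mem_iUnion, cyclicBlade_eq, Set.mem_ofPred_eq, Subtype.exists,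
    exists_prop]
  refine exists_congr fun I => and_congr_right fun hI => ?_
  rw [h𝒞 I hI]
  exact and_iff_right hx.2

/-! ### Multi-splits -/

lemma multiSplit_eq {ℓ : ℕ} {S : Fin ℓ → Finset (Fin n)} {s : Fin ℓ → ℤ}
    (h : IsDecoratedOSP k S s) : multiSplit k S s =
      Set.range fun j => cell (fun _ : Unit => level S s) (hypersimplex k n) fun _ => j := by
  have hS := h.isOrderedPartition
  have := hS.neZero
  have hs : ∑ j, (s j : ℝ) = k := by exact_mod_cast h.2.2.1
  rw [multiSplit]
  congr 1
  funext j
  rw [plate_rotate hS, hs]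
  ext x
  exact ⟨fun hx => ⟨hx.2, hx.1.2⟩, fun hx => ⟨⟨hx.1.2, hx.2⟩, hx.1⟩⟩

/-- Both sides are the chambers of the open hypersimplex cut by the same set of walls. -/
lemma fullCells_level_eq {ℓ : ℕ} (hk : 1 ≤ k) (hkn : k + 1 ≤ n) {S : Fin ℓ → Finset (Fin n)}
    {s : Fin ℓ → ℤ} (h : IsDecoratedOSP k S s) {σ : Equiv.Perm (Fin n)} {J : Finset (Fin n)}
    (hJ : J.card = k)
    (hB : blade S s ∩ intrinsicInterior ℝ (hypersimplex k n) =
      cyclicBlade σ J ∩ intrinsicInterior ℝ (hypersimplex k n)) :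
    fullCells (fun _ : Unit => level S s) (hypersimplex k n) =
      fullCells (fun _ : Unit => cycLevel σ J) (hypersimplex k n) := by
  have hS := h.isOrderedPartition
  have := hS.neZero
  have hs : ∑ j, (s j : ℝ) = k := by exact_mod_cast h.2.2.1
  obtain ⟨y, hyU, -⟩ := exists_generic_point hk hkn
  rw [← chambers_eq_fullCells (B := blade S s) (isClosed_hypersimplex k n)
      openHypersimplex_subset ⟨y, hyU⟩ lineMap_mem_openHypersimplex convex_openHypersimplex,
    ← chambers_eq_fullCells (B := blade S s) (isClosed_hypersimplex k n)
      openHypersimplex_subset ⟨y, hyU⟩ lineMap_mem_openHypersimplex convex_openHypersimplex]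
  · intro x hx
    have h1 : x ∈ blade S s ↔ x ∈ cyclicBlade σ J := by
      have h2 := Set.ext_iff.1 hB x
      have h3 := openHypersimplex_subset_intrinsicInterior hx
      simpa [h3] using h2
    rw [h1, cyclicBlade_eq, hJ]
    exact and_iff_right hx.2
  · intro x hx
    rw [blade_eq hS, hs]
    exact and_iff_right hx.2

theorem commonRefinement_eq {ℓ₁ ℓ₂ : ℕ} (hk : 1 ≤ k) (hkn : k + 1 ≤ n)
    {S : Fin ℓ₁ → Finset (Fin n)} {s : Fin ℓ₁ → ℤ} {T : Fin ℓ₂ → Finset (Fin n)}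
    {t : Fin ℓ₂ → ℤ} (hS : IsDecoratedOSP k S s) (hT : IsDecoratedOSP k T t)
    {σ : Equiv.Perm (Fin n)} {J₁ J₂ : Finset (Fin n)} (hJ₁ : J₁.card = k) (hJ₂ : J₂.card = k)
    (hB₁ : blade S s ∩ intrinsicInterior ℝ (hypersimplex k n) =
      cyclicBlade σ J₁ ∩ intrinsicInterior ℝ (hypersimplex k n))
    (hB₂ : blade T t ∩ intrinsicInterior ℝ (hypersimplex k n) =
      cyclicBlade σ J₂ ∩ intrinsicInterior ℝ (hypersimplex k n)) :
    commonRefinement (hypersimplex k n) (multiSplit k S s) (multiSplit k T t) =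
      fullCells (fun b : Bool => cycLevel σ (cond b J₁ J₂)) (hypersimplex k n) := by
  obtain ⟨y, hyU, hy⟩ := exists_generic_point hk hkn
  have hyQ := openHypersimplex_subset hyU
  have hQ := convex_hypersimplex k n
  have hfull : ∀ {ℓ : ℕ} {S : Fin ℓ → Finset (Fin n)} {s : Fin ℓ → ℤ} {J : Finset (Fin n)},
      IsDecoratedOSP k S s → J.card = k →
      blade S s ∩ intrinsicInterior ℝ (hypersimplex k n) =
        cyclicBlade σ J ∩ intrinsicInterior ℝ (hypersimplex k n) →
      ∀ P, (P ∈ multiSplit k S s ∧ affineSpan ℝ P = affineSpan ℝ (hypersimplex k n)) ↔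
        P ∈ fullCells (fun _ : Unit => cycLevel σ J) (hypersimplex k n) := by
    intro ℓ S s J hS hJ hB P
    have hrange : multiSplit k S s =
        Set.range (cell (fun _ : Unit => level S s) (hypersimplex k n)) := by
      rw [multiSplit_eq hS]
      ext P
      constructor
      · rintro ⟨j, rfl⟩; exact ⟨fun _ => j, rfl⟩
      · rintro ⟨f, rfl⟩; exact ⟨f (), rfl⟩
    rw [← fullCells_level_eq hk hkn hS hJ hB,
      mem_fullCells_iff hQ hyQ fun _ => level_ne_of_generic hS.isOrderedPartition s hy, hrange]
  have hinter : ∀ f : Bool → Fin n,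
      cell (fun b : Bool => cycLevel σ (cond b J₁ J₂)) (hypersimplex k n) f =
        cell (fun _ : Unit => cycLevel σ J₁) (hypersimplex k n) (fun _ => f true) ∩
          cell (fun _ : Unit => cycLevel σ J₂) (hypersimplex k n) fun _ => f false := by
    intro f
    ext x
    simp only [cell, Set.mem_inter_iff, Set.mem_ofPred_eq, Bool.forall_bool, forall_const,
      cond_true, cond_false]
    tauto
  have hgen := fun b : Bool => cycLevel_ne_of_generic σ (cond b J₁ J₂) hy
  ext R
  rw [mem_fullCells_iff hQ hyQ hgen]
  constructor
  · rintro ⟨P₁, hP₁, P₂, hP₂, rfl, hspan⟩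
    -- A cell of a multi-split containing a full-dimensional intersection is itself
    -- full-dimensional, so no separate dimension count for multi-splits is needed.
    have hsub : ∀ {ℓ : ℕ} {S : Fin ℓ → Finset (Fin n)} {s : Fin ℓ → ℤ}, ∀ P ∈ multiSplit k S s,
        P₁ ∩ P₂ ⊆ P → affineSpan ℝ P = affineSpan ℝ (hypersimplex k n) := by
      rintro ℓ S s _ ⟨j, rfl⟩ h
      refine le_antisymm (affineSpan_mono ℝ Set.inter_subset_right) ?_
      rw [← hspan]
      exact affineSpan_mono ℝ h
    obtain ⟨f₁, -, h₁⟩ := (hfull hS hJ₁ hB₁ P₁).1 ⟨hP₁, hsub P₁ hP₁ Set.inter_subset_left⟩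
    obtain ⟨f₂, -, h₂⟩ := (hfull hT hJ₂ hB₂ P₂).1 ⟨hP₂, hsub P₂ hP₂ Set.inter_subset_right⟩
    refine ⟨⟨fun b => cond b (f₁ ()) (f₂ ()), ?_⟩, hspan⟩
    rw [hinter, h₁, h₂]
    rfl
  · rintro ⟨⟨f, rfl⟩, hspan⟩
    obtain ⟨x, hx⟩ := openCell_nonempty_of_affineSpan hQ hyQ hgen hspan
    have h₁ := (hfull hS hJ₁ hB₁ _).2
      ⟨fun _ => f true, ⟨x, hx.1, fun _ u hu => hx.2 true u hu⟩, rfl⟩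
    have h₂ := (hfull hT hJ₂ hB₂ _).2
      ⟨fun _ => f false, ⟨x, hx.1, fun _ u hu => hx.2 false u hu⟩, rfl⟩
    exact ⟨_, h₁.1, _, h₂.1, hinter f, hspan⟩

end Main

end BladeArrangement

theorem mainTheorem1 (n k : ℕ) (hk : 1 ≤ k) (hkn : k + 1 ≤ n) :
    (∀ 𝒞 : Finset (Finset (Fin n)), (∀ I ∈ 𝒞, I.card = k) →
      (IsMatroidSubdivision (hypersimplex k n)
          (chambers (hypersimplex k n)
            (bladeArrangement (Equiv.refl (Fin n)) 𝒞)) ↔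
        IsWeaklySeparatedCollection (Equiv.refl (Fin n)) 𝒞) ∧
      (IsMatroidSubdivision (hypersimplex k n)
          (chambers (hypersimplex k n)
            (bladeArrangement (Equiv.refl (Fin n)) 𝒞)) →
        ∀ P ∈ chambers (hypersimplex k n)
            (bladeArrangement (Equiv.refl (Fin n)) 𝒞),
          IsPositroidPolytope k P)) ∧
    (∀ (ℓ₁ ℓ₂ : ℕ) (S : Fin ℓ₁ → Finset (Fin n)) (s : Fin ℓ₁ → ℤ)
        (T : Fin ℓ₂ → Finset (Fin n)) (t : Fin ℓ₂ → ℤ)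
        (σ : Equiv.Perm (Fin n)) (J₁ J₂ : Finset (Fin n)),
      IsDecoratedOSP k S s → IsDecoratedOSP k T t →
      J₁.card = k → J₂.card = k →
      blade S s ∩ intrinsicInterior ℝ (hypersimplex k n) =
        cyclicBlade σ J₁ ∩
          intrinsicInterior ℝ (hypersimplex k n) →
      blade T t ∩ intrinsicInterior ℝ (hypersimplex k n) =
        cyclicBlade σ J₂ ∩
          intrinsicInterior ℝ (hypersimplex k n) →
      (IsMatroidSubdivision (hypersimplex k n)
          (commonRefinement (hypersimplex k n)
            (multiSplit k S s) (multiSplit k T t)) ↔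
        WeaklySeparated σ J₁ J₂)) := by
  have : NeZero n := ⟨by omega⟩
  refine ⟨fun 𝒞 h𝒞 => ?_, ?_⟩
  · rw [chambers_bladeArrangement hk hkn _ 𝒞 h𝒞]
    refine ⟨?_, fun hM P hP => ⟨hM.2 P hP, ?_⟩⟩
    · rw [isMatroidSubdivision_fullCells_iff hk hkn _ fun I : 𝒞 => h𝒞 I.1 I.2]
      simp only [IsWeaklySeparatedCollection, Subtype.forall]
    · obtain ⟨f, hf, rfl⟩ := hP
      exact isPositroid_cut hkn hk (fun I : 𝒞 => h𝒞 I.1 I.2) (hf.mono openCell_subset_cell)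
  · intro ℓ₁ ℓ₂ S s T t σ J₁ J₂ hS hT hJ₁ hJ₂ hB₁ hB₂
    rw [commonRefinement_eq hk hkn hS hT hJ₁ hJ₂ hB₁ hB₂,
      isMatroidSubdivision_fullCells_iff hk hkn σ (by simp [hJ₁, hJ₂])]
    constructor
    · intro h
      exact h true false
    · intro h
      simp only [Bool.forall_bool, cond_true, cond_false]
      exact ⟨⟨.refl _ _, h.symm⟩, h, .refl _ _⟩
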